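/- Let $\mathscr V$ be a Polish space, $\nu$ a $\sigma$-finite Borel measure on $\mathscr V$ and $f_1,\dots,f_n:\mathscr V\to[0,\infty)$ measurable. For $g\ge 0$ put $\Lambda(g)=\int(1-e^{-g(v)})\,\nu(dv)$, and for $w\in[0,\infty)^n$ put $\Omega_n(v)=\sum_{i=1}^n w_if_i(v)$ and $\nu_{\Omega_n}(dv)=e^{-\Omega_n(v)}\nu(dv)$; assume $\Lambda(\Omega_n)<\infty$ for all $w\in[0,\infty)^n$. Let $\mathscr M(d\mathbf v\mid\nu_{\Omega_n})=\sum_{\mathbf p}\prod_{j}\nu_{\Omega_n}(dv_j^*)$ be the $n$-th moment measure on $\mathscr V^n$ of a Poisson random measure with intensity $\nu_{\Omega_n}$, the sum being over the partitions $\mathbf p=\{C_1,\dots,C_{n(\mathbf p)}\}$ of $\{1,\dots,n\}$, with $v_i=v_j^*$ for $i\in C_j$. Let $\phi(\cdot\mid a,s)$ be the normal density with mean $a$ and variance $s$, and let $f_{GIG}(\cdot\mid\lambda,\delta,\gamma)$ be the generalized inverse Gaussian density, $f_{GIG}(t\mid\lambda,\delta,\gamma)=\frac{(\gamma/\delta)^\lambda}{2K_\lambda(\delta\gamma)}t^{\lambda-1}e^{-(\delta^2/t+\gamma^2t)/2}$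 for $t>0$ (for $\delta=0<\lambda,\gamma$: the gamma density of shape $\lambda$ and rate $\gamma^2/2$). Model. $N$ is a Poisson random measure on $\mathscr V$ with intensity $\nu$, $\tau_i=N(f_i)$; $Z_1,\dots,Z_n$ are i.i.d. gamma with shape $1$ and scale $1$; $\epsilon_1,\dots,\epsilon_n$ are i.i.d. standard normal; $N$, $(Z_i)$, $(\epsilon_i)$ are independent. For real $\mu,\Delta,\beta$ let $X_i=\mu\Delta+(\tau_i/Z_i)\beta+(\tau_i/Z_i)^{1/2}\epsilon_i$ and $W_i=Z_i/\tau_i$. Given $(N,Z,\epsilon)$ with all $\tau_i>0$, the latent variables $V_1,\dots,V_n\in\mathscr V$ are independent with $V_i\sim f_i(v)N(dv)/\tau_i$. Put $A_i=X_i-\mu\Delta$ (for an observed value $x$, $A_i=x_i-\mu\Delta$), $\mathscr B(w)=\int\prod_i f_i(v_i)\,\mathscr M(d\mathbf v\mid\nu_{\Omega_n})$ and $$\mathscr L(x)=\int_{(0,\infty)^n}\Big[\prod_{i=1}^n\phi(x_i\mid\mu\Delta+\beta w_i^{-1},w_i^{-1})\Big]\,\mathbb E\Big[\prod_{i=1}^n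 e^{-w_i\tau_i}\tau_i\Big]dw .$$ Posterior laws are regular conditional distributions. They are described for almost every value of the conditioning variables (with respect to their joint law) such that the observation $x$ of $X$ has $x_i\ne\mu\Delta$ for all $i$; if $\tau_1,\dots,\tau_n>0$ almost surely, then $X_i\ne\mu\Delta$ for all $i$ almost surely, so that this excludes nothing. The sign $\propto$ means that the right-hand side is a measure of total mass in $(0,\infty)$ and the left-hand side is this measure divided by its total mass. Then the joint posterior of $(V,W)$ given $X=x$ is, on $\mathscr V^n\times(0,\infty)^n$, $$\mathscr P_x(d\mathbf v,d\mathbf w)\propto\Big[\prod_{i=1}^n f_i(v_i)\Big]\mathscr M(d\mathbf v\mid\nu_{\Omega_n})\,e^{-\Lambda(\Omega_n)}\prod_{i=1}^n\phi(x_i\mid\mu\Delta+\beta w_i^{-1},w_i^{-1})\,dw_i .$$ In particular: (i) if $\nu$ has no atoms, then, with $v_1^*,\dots,v^*_{n(\mathbf p)}$ the distinct values among $v_1,\dots,v_n$, the posterior of $W$ given $V=\mathbf v$, $X=x$ is $\propto e^{-\Lambda(\Omega_n)}\prod_{i=1}^n f_{GIG}\big(w_i\mid 3/2,|\beta|,\sqrt{A_i^2+2\sum_{j}f_i(v_j^*)}\big)\,dw_i$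 on $(0,\infty)^n$; (ii) the posterior of $V$ given $W=w$, $X=x$ is $\propto\big[\prod_{i}f_i(v_i)\big]\mathscr M(d\mathbf v\mid\nu_{\Omega_n})=\big[\prod_{j}\prod_{i\in C_j}f_i(v_j^*)\big]\mathscr M(d\mathbf v\mid\nu_{\Omega_n})$, where in the last expression the $v_j^*$ are the distinct values of $\mathbf v$ and $C_j=\{i:v_i=v_j^*\}$; (iii) $0<\mathscr L(x)<\infty$, and the posterior of $W$ given $X=x$ is $\mathscr B(w)\,e^{-\Lambda(\Omega_n)}\prod_{i=1}^n\phi(x_i\mid\mu\Delta+\beta w_i^{-1},w_i^{-1})\,dw_i\,/\,\mathscr L(x)$ on $(0,\infty)^n$. -/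

import Mathlib

open MeasureTheory ProbabilityTheory
open scoped ENNReal NNReal

noncomputable section

namespace GHVol

/-! ### Poisson random measures -/

/-- `N` is a Poisson random measure on `E` with intensity `ν`, on the probability space `(S, P)`:
a random measure, independent over disjoint sets, with `N B ~ Poisson (ν B)` if `ν B < ∞`. -/
structure IsPoissonRandomMeasure {S E : Type*} [MeasurableSpace S] [MeasurableSpace E]
    (P : Measure S) (N : S → Measure E) (ν : Measure E) : Prop where
  measurable : Measurable N
  poisson : ∀ B : Set E, MeasurableSet B → ν B < ∞ →
    P.map (fun ω => N ω B) =
      (poissonMeasure (ν B).toNNReal).map (fun k : ℕ => (k : ℝ≥0∞))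
  indep : ∀ (k : ℕ) (B : Fin k → Set E), (∀ i, MeasurableSet (B i)) →
    Pairwise (fun i j => Disjoint (B i) (B j)) → iIndepFun (fun i ω => N ω (B i)) P

/-- `Λ(g) = ∫ (1 - e^{-g(v)}) ν(dv)`, for `g ≥ 0`. -/
def laplaceExponent {E : Type*} [MeasurableSpace E] (ν : Measure E) (g : E → ℝ) : ℝ≥0∞ :=
  ∫⁻ v, ENNReal.ofReal (1 - Real.exp (-g v)) ∂ν

/-- `e^{-Λ(g)}`, used where `Λ(g) < ∞`. -/
def expNegLaplace {E : Type*} [MeasurableSpace E] (ν : Measure E) (g : E → ℝ) : ℝ≥0∞ :=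
  ENNReal.ofReal (Real.exp (-(laplaceExponent ν g).toReal))

/-- `Ω_n(v) = ∑ i, w_i f_i(v)`. -/
def bigOmega {n : ℕ} {E : Type*} (f : Fin n → E → ℝ≥0) (w : Fin n → ℝ) (v : E) : ℝ :=
  ∑ i, w i * (f i v : ℝ)

/-- The exponentially tilted intensity `ν_g(dv) = e^{-g(v)} ν(dv)`. -/
def tilted {E : Type*} [MeasurableSpace E] (ν : Measure E) (g : E → ℝ) : Measure E :=
  ν.withDensity (fun v => ENNReal.ofReal (Real.exp (-g v)))

/-- The `n`-th moment measure `𝓜(dv | ν)` on `E^n` of a Poisson random measure with intensity `ν`: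
the sum, over the partitions `p = {C_1, …, C_k}` of `{1, …, n}`, of the measures
`∏ j, ν(dv*_j)`, where `v_i = v*_j` for `i ∈ C_j`. -/
def momentMeasure (n : ℕ) {E : Type*} [MeasurableSpace E] (ν : Measure E) :
    Measure (Fin n → E) :=
  ∑ p : Finpartition (Finset.univ : Finset (Fin n)),
    (Measure.pi (fun _ : p.parts => ν)).map
      (fun y i => y ⟨p.part i, p.part_mem.2 (Finset.mem_univ i)⟩)

/-! ### The generalized inverse Gaussian density -/

/-- The modified Bessel function of the second kind `K_l(z)`, for `z > 0`. -/
def besselK (l z : ℝ) : ℝ :=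
  ∫ t in Set.Ioi (0 : ℝ), Real.exp (-(z * Real.cosh t)) * Real.cosh (l * t)

open Classical in
/-- The density of `GIG(l, δ, v)` (`δ, v ≥ 0`), including its limiting cases `GIG(l, 0, v)`
(`l, v > 0`, a gamma law) and `GIG(l, δ, 0)` (`l < 0 < δ`, a reciprocal gamma law). -/
def gigPDF (l δ v t : ℝ) : ℝ :=
  if t ≤ 0 then 0
  else if δ = 0 then gammaPDFReal l (v ^ 2 / 2) t
  else if v = 0 then
    (δ ^ 2 / 2) ^ (-l) / Real.Gamma (-l) * t ^ (l - 1) * Real.exp (-(δ ^ 2 / 2 * t⁻¹))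
  else (v / δ) ^ l / (2 * besselK l (δ * v)) * t ^ (l - 1) *
    Real.exp (-(1 / 2) * (δ ^ 2 * t⁻¹ + v ^ 2 * t))

/-! ### The model -/

section Model

variable {n : ℕ} {S E : Type*} [MeasurableSpace S] [MeasurableSpace E]

/-- `τ_i = N(f_i)`. -/
def tau (f : Fin n → E → ℝ≥0) (N : S → Measure E) (ω : S) (i : Fin n) : ℝ≥0∞ :=
  ∫⁻ v, (f i v : ℝ≥0∞) ∂(N ω)

/-- The returns `X_i = m + (τ_i / Z_i) β + (τ_i / Z_i)^{1/2} ε_i`. -/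
def returns (m β : ℝ) (f : Fin n → E → ℝ≥0) (N : S → Measure E) (Z ε : S → Fin n → ℝ)
    (ω : S) (i : Fin n) : ℝ :=
  m + (tau f N ω i).toReal / Z ω i * β + √((tau f N ω i).toReal / Z ω i) * ε ω i

/-- The latent variables `W_i = Z_i / τ_i`. -/
def latentW (f : Fin n → E → ℝ≥0) (N : S → Measure E) (Z : S → Fin n → ℝ)
    (ω : S) (i : Fin n) : ℝ :=
  Z ω i / (tau f N ω i).toReal

/-- The model: `N` is a Poisson random measure with intensity `ν`, the `Z_i` are gamma variables
of shape `1` and scale `1`, the `ε_i` are standard normal, all of these are independent, and,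
given `(N, Z, ε)` with `τ_1, …, τ_n > 0`, the missing values `V_1, …, V_n` are independent with
`V_i ~ f_i(v) N(dv) / τ_i`. -/
structure IsModel (P : Measure S) (ν : Measure E) (f : Fin n → E → ℝ≥0)
    (N : S → Measure E) (Z ε : S → Fin n → ℝ) (V : S → Fin n → E) : Prop where
  poisson : IsPoissonRandomMeasure P N ν
  measurable_Z : Measurable Z
  measurable_ε : Measurable ε
  measurable_V : Measurable V
  law_Z : P.map Z = Measure.pi (fun _ => gammaMeasure 1 1)
  law_ε : P.map ε = Measure.pi (fun _ => gaussianReal 0 1)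
  indep_Z : IndepFun N Z P
  indep_ε : IndepFun (fun ω => (N ω, Z ω)) ε P
  cond_V : ∀ B : Fin n → Set E, (∀ i, MeasurableSet (B i)) →
    ∀ᵐ ω ∂P, (∀ i, 0 < tau f N ω i) →
      (P⟦{ω' | ∀ i, V ω' i ∈ B i} |
          MeasurableSpace.comap (fun ω' => (N ω', Z ω', ε ω')) inferInstance⟧) ω =
        ∏ i, ((∫⁻ v in B i, (f i v : ℝ≥0∞) ∂(N ω)) / tau f N ω i).toReal

end Model

/-! ### Likelihood and posterior measures -/

section Posterior

variable {n : ℕ} {S E : Type*} [MeasurableSpace S] [MeasurableSpace E]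

/-- Lebesgue measure `dw` on `(0, ∞)^n`. -/
def orthantVolume (n : ℕ) : Measure (Fin n → ℝ) :=
  volume.restrict {w | ∀ i, 0 < w i}

/-- `∏ i, φ(x_i | m + β w_i⁻¹, w_i⁻¹)`, with `φ(· | a, s)` the normal density of mean `a` and
variance `s`. -/
def normalFactor (m β : ℝ) (x w : Fin n → ℝ) : ℝ≥0∞ :=
  ∏ i, gaussianPDF (m + β * (w i)⁻¹) (Real.toNNReal (w i)⁻¹) (x i)

/-- The likelihood
`𝓛(x) = ∫ (∏ i, φ(x_i | m + β w_i⁻¹, w_i⁻¹)) 𝔼[∏ i, e^{-w_i τ_i} τ_i] dw` over `(0, ∞)^n`. -/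
def likelihood (P : Measure S) (f : Fin n → E → ℝ≥0) (N : S → Measure E) (m β : ℝ)
    (x : Fin n → ℝ) : ℝ≥0∞ :=
  ∫⁻ w, normalFactor m β x w *
    (∫⁻ ω, ∏ i, ENNReal.ofReal
      (Real.exp (-(w i * (tau f N ω i).toReal)) * (tau f N ω i).toReal) ∂P) ∂(orthantVolume n)

/-- The measure `(∏ i, f_i(v_i)) 𝓜(dv | ν_{Ω_n})` on `E^n`, for fixed `w`. -/
def weightedMoment (ν : Measure E) (f : Fin n → E → ℝ≥0) (w : Fin n → ℝ) :
    Measure (Fin n → E) :=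
  (momentMeasure n (tilted ν (bigOmega f w))).withDensity (fun v => ∏ i, (f i (v i) : ℝ≥0∞))

open Classical in
/-- The measure `(∏ j, ∏ i ∈ C_j, f_i(v*_j)) 𝓜(dv | ν_{Ω_n})`, where the `v*_j` are the distinct
values of `v` and `C_j = {i : v_i = v*_j}`. -/
def weightedMomentByCells (ν : Measure E) (f : Fin n → E → ℝ≥0) (w : Fin n → ℝ) :
    Measure (Fin n → E) :=
  (momentMeasure n (tilted ν (bigOmega f w))).withDensity
    (fun v => ∏ a ∈ Finset.univ.image v, ∏ i with v i = a, (f i a : ℝ≥0∞))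

/-- `𝓑(w) = ∫ ∏ i, f_i(v_i) 𝓜(dv | ν_{Ω_n})`. -/
def scriptB (ν : Measure E) (f : Fin n → E → ℝ≥0) (w : Fin n → ℝ) : ℝ≥0∞ :=
  ∫⁻ v, ∏ i, (f i (v i) : ℝ≥0∞) ∂(momentMeasure n (tilted ν (bigOmega f w)))

/-- The measure
`(∏ i, f_i(v_i)) 𝓜(dv | ν_{Ω_n}) e^{-Λ(Ω_n)} ∏ i, φ(x_i | m + β w_i⁻¹, w_i⁻¹) dw_i`
on `E^n × (0, ∞)^n` (as a measure on `E^n × ℝ^n`). -/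
def jointMeasure (ν : Measure E) (f : Fin n → E → ℝ≥0) (m β : ℝ) (x : Fin n → ℝ) :
    Measure ((Fin n → E) × (Fin n → ℝ)) :=
  ((orthantVolume n).withDensity
    (fun w => expNegLaplace ν (bigOmega f w) * normalFactor m β x w)).bind
      (fun w => (weightedMoment ν f w).map (fun v => (v, w)))

open Classical in
/-- The sum `∑ j, g(v*_j)` over the distinct values `v*_1, …, v*_k` of `v_1, …, v_n`. -/
def sumDistinct (g : E → ℝ≥0) (v : Fin n → E) : ℝ :=
  ∑ a ∈ Finset.univ.image v, (g a : ℝ)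

/-- The measure
`e^{-Λ(Ω_n)} ∏ i, f_GIG(w_i | 3/2, |β|, √((x_i - m)² + 2 ∑ j, f_i(v*_j))) dw_i` on `(0, ∞)^n`. -/
def gigMeasure (ν : Measure E) (f : Fin n → E → ℝ≥0) (m β : ℝ) (v : Fin n → E)
    (x : Fin n → ℝ) : Measure (Fin n → ℝ) :=
  (orthantVolume n).withDensity (fun w => expNegLaplace ν (bigOmega f w) *
    ∏ i, ENNReal.ofReal
      (gigPDF (3 / 2) |β| (√((x i - m) ^ 2 + 2 * sumDistinct (f i) v)) (w i)))

/-- `π ∝ ρ`: the measure `ρ` is nonzero and finite, and `π` is `ρ` divided by its total mass. -/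
def IsNormalization {α : Type*} [MeasurableSpace α] (π ρ : Measure α) : Prop :=
  0 < ρ Set.univ ∧ ρ Set.univ < ∞ ∧ π = (ρ Set.univ)⁻¹ • ρ

end Posterior

end GHVol

end

/-! Everything follows from an explicit joint law of `(W, X, V)`, from which the posteriors are read
off by Bayes' rule.

Condition on `N` with all `τ_i` positive and finite. Since `Z_i` is exponential, `W_i = Z_i / τ_i`
has density `τ_i e^{-w τ_i}` on the half-line, and given `W = w` the return `X_i` is normal with
variance `1 / w_i` (`lintegral_gamma_gaussian`). The denominators in the laws `f_i N(dv) / τ_i` of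
the `V_i` cancel the factors `τ_i` of these densities. What remains to be averaged over `N` is
`e^{-N(Ω_n)} ∏ N(f_i 1_{B_i})` (`IsModel.measure_joint_box`).

That mean is given by `palm_formula`. The Mecke formula (`mecke`), applied to one factor `N(h_a)`,
adds a point `v` to `N`: this multiplies `e^{-N(g)}` by `e^{-g(v)}` and turns every other `N(h_i)`
into `N(h_i) + h_i(v)`. Expanding the product over subsets `J` singles out the indices that share
the point `v` with `a`, which is the recursion for set partitions in terms of the cell of `a`
(`sum_finpartition_insert`). Induction then yields the moment measure of the tilted intensity,
starting from the Laplace functional `e^{-Λ(g)}`. The Mecke formula itself rests on the identity `k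
p_k = r p_{k-1}` for Poisson weights.

If `τ_i = 0` then `X_i = m` exactly, so observations with all `x_i ≠ m` only see the event where the
joint law is known. There `ae_isNormalization_condDistrib` converts joint densities into conditional
distributions. For (i), absence of atoms makes the points of different cells almost surely distinct.
The tilt `e^{-Ω_n}` then becomes a density in `(v, w)` against a measure free of `w`, and its
product with the normal densities is of GIG form up to a factor independent of `w`. -/

noncomputable section

namespace GHVol

/-! ### Integrals and densities on finite products. -/

section Pi

variable {ι : Type*} [Fintype ι] {α : ι → Type*} [∀ i, MeasurableSpace (α i)]

/-- Integrating out one more coordinate affects only its own factor, since the other factors do not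
see the update. -/
theorem lmarginal_prod [DecidableEq ι] (μ : ∀ i, Measure (α i)) [∀ i, SigmaFinite (μ i)]
    (f : ∀ i, α i → ℝ≥0∞) (hf : ∀ i, Measurable (f i)) (s : Finset ι) (x : ∀ i, α i) :
    (∫⋯∫⁻_s, (fun x => ∏ i, f i (x i)) ∂μ) x =
      (∏ i ∈ s, ∫⁻ y, f i y ∂μ i) * ∏ i ∈ sᶜ, f i (x i) := by
  have hm : Measurable (fun x : ∀ i, α i => ∏ i, f i (x i)) :=
    Finset.measurable_prod _ fun i _ => (hf i).comp (measurable_pi_apply i)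
  induction s using Finset.induction_on generalizing x with
  | empty => simp
  | insert a s ha ih =>
    rw [lmarginal_insert _ hm ha]
    simp_rw [ih]
    have hc : sᶜ = insert a (insert a s)ᶜ := by
      ext j
      simp only [Finset.mem_compl, Finset.mem_insert, not_or]
      by_cases hj : j = a <;> simp [hj, ha]
    have ha' : a ∉ (insert a s)ᶜ := by simp
    have key : ∀ y, ∏ i ∈ sᶜ, f i (Function.update x a y i) =
        f a y * ∏ i ∈ (insert a s)ᶜ, f i (x i) := by
      intro y
      rw [hc, Finset.prod_insert ha', Function.update_self]
      congr 1
      refine Finset.prod_congr rfl fun i hi => ?_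
      rw [Function.update_of_ne]
      rintro rfl
      exact ha' hi
    simp_rw [key]
    rw [lintegral_const_mul _ ((hf a).mul_const _), lintegral_mul_const _ (hf a),
      Finset.prod_insert ha]
    ring

theorem lintegral_pi_prod (μ : ∀ i, Measure (α i)) [∀ i, SigmaFinite (μ i)]
    (f : ∀ i, α i → ℝ≥0∞) (hf : ∀ i, Measurable (f i)) :
    ∫⁻ x, ∏ i, f i (x i) ∂(Measure.pi μ) = ∏ i, ∫⁻ y, f i y ∂μ i := by
  classical
  -- Marginals need a base point. If the product is empty, so is one of its factors, and both sides
  -- vanish.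
  rcases isEmpty_or_nonempty (∀ i, α i) with h | ⟨⟨x⟩⟩
  · obtain ⟨i, hi⟩ := isEmpty_pi.1 h
    rw [Measure.eq_zero_of_isEmpty (Measure.pi μ), lintegral_zero_measure]
    refine (Finset.prod_eq_zero (Finset.mem_univ i) ?_).symm
    rw [Measure.eq_zero_of_isEmpty (μ i), lintegral_zero_measure]
  · rw [lintegral_eq_lmarginal_univ x, lmarginal_prod μ f hf]
    simp

theorem prod_indicator {ι : Type*} [Fintype ι] {α : ι → Type*} (B : ∀ i, Set (α i))
    (h : ∀ i, α i → ℝ≥0∞) (v : ∀ i, α i) :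
    ∏ i, (B i).indicator (h i) (v i) =
      (Set.univ.pi B).indicator (fun v => ∏ i, h i (v i)) v := by
  by_cases hv : v ∈ Set.univ.pi B
  · rw [Set.indicator_of_mem hv]
    exact Finset.prod_congr rfl fun i _ => Set.indicator_of_mem (hv i trivial) _
  · rw [Set.indicator_of_notMem hv]
    simp only [Set.mem_pi, Set.mem_univ, forall_const, not_forall] at hv
    obtain ⟨i, hi⟩ := hv
    exact Finset.prod_eq_zero (Finset.mem_univ i) (Set.indicator_of_notMem hi _)

theorem pi_withDensity (μ : ∀ i, Measure (α i)) [∀ i, SigmaFinite (μ i)]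
    (f : ∀ i, α i → ℝ≥0∞) (hf : ∀ i, Measurable (f i))
    [∀ i, SigmaFinite ((μ i).withDensity (f i))] :
    Measure.pi (fun i => (μ i).withDensity (f i)) =
      (Measure.pi μ).withDensity (fun x => ∏ i, f i (x i)) := by
  refine Measure.pi_eq fun s hs => ?_
  rw [withDensity_apply _ (MeasurableSet.univ_pi hs), ← lintegral_indicator (MeasurableSet.univ_pi hs)]
  simp_rw [← prod_indicator s f]
  rw [lintegral_pi_prod μ _ fun i => (hf i).indicator (hs i)]
  refine Finset.prod_congr rfl fun i _ => ?_
  rw [withDensity_apply _ (hs i), lintegral_indicator (hs i)]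

end Pi

/-- With the other coordinates frozen, `y c = y d` confines `y c` to a single point, which is null.
There are finitely many pairs to discard. -/
theorem pi_ae_injective {ι E : Type*} [Fintype ι] [MeasurableSpace E] [MeasurableEq E]
    (ν : Measure E) [SigmaFinite ν] (hν : ∀ v, ν {v} = 0) :
    ∀ᵐ y ∂(Measure.pi (fun _ : ι => ν)), Function.Injective y := by
  classical
  have key : ∀ c d : ι, c ≠ d → ∀ᵐ y ∂(Measure.pi (fun _ : ι => ν)), y c ≠ y d := by
    intro c d hcd
    have hm : MeasurableSet {y : ι → E | y c = y d} :=
      measurableSet_eq_fun (measurable_pi_apply c) (measurable_pi_apply d)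
    rw [ae_iff]
    simp only [ne_eq, not_not]
    rcases isEmpty_or_nonempty (ι → E) with h | ⟨⟨x⟩⟩
    · rw [Measure.eq_zero_of_isEmpty (Measure.pi fun _ : ι => ν)]; rfl
    · rw [← lintegral_indicator_one hm, lintegral_eq_lmarginal_univ x,
        lmarginal_erase' _ (measurable_one.indicator hm) (Finset.mem_univ c)]
      have : (fun x : ι → E => ∫⁻ z, ({y : ι → E | y c = y d}.indicator (1 : (ι → E) → ℝ≥0∞))
          (Function.update x c z) ∂ν) = fun _ => 0 := by
        funext x
        have : ∀ z, ({y : ι → E | y c = y d}.indicator (1 : (ι → E) → ℝ≥0∞))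
            (Function.update x c z) = ({x d} : Set E).indicator 1 z := by
          intro z
          simp only [Set.indicator_apply, Set.mem_ofPred_eq, Function.update_self,
            Function.update_of_ne hcd.symm, Set.mem_singleton_iff, Pi.one_apply]
        simp_rw [this]
        have hs : MeasurableSet ({x d} : Set E) := by
          have := (measurable_id.prodMk measurable_const : Measurable fun z : E => (z, x d))
            (measurableSet_diagonal (α := E))
          convert this using 1
          ext z; simp
        rw [lintegral_indicator_one hs, hν]
      rw [this]
      simp [lmarginal]
  have hall : ∀ᵐ y ∂(Measure.pi (fun _ : ι => ν)), ∀ c d : ι, c ≠ d → y c ≠ y d := by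
    rw [ae_all_iff]; intro c
    rw [ae_all_iff]; intro d
    by_cases h : c = d
    · simp [h]
    · filter_upwards [key c d h] with y hy _ using hy
  filter_upwards [hall] with y hy c d hcd
  by_contra h
  exact hy c d h hcd

/-- Bayes' rule for an unnormalized conditional kernel that is known only over `A`. Nothing is
assumed finite: over `A` the total mass `κ x univ` is a density of the law of `X`, so it is almost
surely positive, and finite because it integrates to at most one. -/
theorem ae_isNormalization_condDistrib {S α β : Type*} [MeasurableSpace S] [MeasurableSpace α]
    [MeasurableSpace β] [StandardBorelSpace β] [Nonempty β]
    (P : Measure S) [IsProbabilityMeasure P] {X : S → α} {Y : S → β}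
    (hX : Measurable X) (hY : Measurable Y) {A : Set α} (hA : MeasurableSet A)
    (lam : Measure α) (κ : Kernel α β)
    (h : ∀ D : Set α, MeasurableSet D → D ⊆ A → ∀ B : Set β, MeasurableSet B →
      P (X ⁻¹' D ∩ Y ⁻¹' B) = ∫⁻ x in D, κ x B ∂lam) :
    ∀ᵐ x ∂(P.map X), x ∈ A → IsNormalization (condDistrib Y X P x) (κ x) := by
  have hPX : IsProbabilityMeasure (P.map X) := Measure.isProbabilityMeasure_map hX.aemeasurable
  set ρ : α → ℝ≥0∞ := fun x => κ x Set.univ with hρdef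
  have hρ : Measurable ρ := κ.measurable_coe MeasurableSet.univ
  have hdens : ∀ D : Set α, MeasurableSet D → D ⊆ A → P.map X D = ∫⁻ x in D, ρ x ∂lam := by
    intro D hD hDA
    rw [Measure.map_apply hX hD, ← h D hD hDA _ MeasurableSet.univ]
    simp
  have hrest : ∀ D : Set α, MeasurableSet D → D ⊆ A →
      (P.map X).restrict D = (lam.restrict D).withDensity ρ := by
    intro D hD hDA
    ext C hC
    rw [Measure.restrict_apply hC, hdens _ (hC.inter hD) (Set.inter_subset_right.trans hDA),
      withDensity_apply _ hC, Measure.restrict_restrict hC]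
  have hfin : ∀ᵐ x ∂(P.map X), x ∈ A → ρ x < ∞ := by
    rw [← ae_restrict_iff' hA, hrest A hA subset_rfl]
    refine (withDensity_absolutelyContinuous _ _).ae_le ?_
    refine ae_lt_top hρ ?_
    rw [← hdens A hA subset_rfl]
    exact measure_ne_top _ _
  have hpos : ∀ᵐ x ∂(P.map X), x ∈ A → 0 < ρ x := by
    rw [ae_iff]
    have : {x | ¬(x ∈ A → 0 < ρ x)} = A ∩ ρ ⁻¹' {0} := by
      ext x; simp
    rw [this, hdens _ (hA.inter (hρ (measurableSet_singleton 0))) Set.inter_subset_left]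
    rw [setLIntegral_congr_fun (g := fun _ => 0) (hA.inter (hρ (measurableSet_singleton 0)))
      (fun x hx => hx.2)]
    simp
  set A' : Set α := A ∩ {x | 0 < ρ x ∧ ρ x < ∞} with hA'def
  have hA' : MeasurableSet A' := hA.inter
    ((measurableSet_lt measurable_const hρ).inter (measurableSet_lt hρ measurable_const))
  classical
  let κ' : Kernel α β := ⟨fun x => (ρ x)⁻¹ • κ x, by
    refine Measure.measurable_of_measurable_coe _ fun B hB => ?_
    simp only [Measure.smul_apply, smul_eq_mul]
    exact hρ.inv.mul (κ.measurable_coe hB)⟩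
  have hκ' : ∀ x, κ' x = (ρ x)⁻¹ • κ x := fun _ => rfl
  -- Using the conditional distribution itself off `A'` makes `η` a Markov kernel on the whole
  -- space, so that uniqueness of the disintegration applies.
  let η : Kernel α β := Kernel.piecewise hA' κ' (condDistrib Y X P)
  have hηin : ∀ x ∈ A', η x = (ρ x)⁻¹ • κ x := fun x hx => by
    rw [Kernel.piecewise_apply, if_pos hx, hκ']
  have hηout : ∀ x ∉ A', η x = condDistrib Y X P x := fun x hx => by
    rw [Kernel.piecewise_apply, if_neg hx]
  have hη : IsMarkovKernel η := ⟨fun x => by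
    by_cases hx : x ∈ A'
    · rw [hηin x hx]
      constructor
      rw [Measure.smul_apply, smul_eq_mul]
      exact ENNReal.inv_mul_cancel hx.2.1.ne' hx.2.2.ne
    · rw [hηout x hx]; infer_instance⟩
  have hprod : P.map (fun ω => (X ω, Y ω)) = P.map X ⊗ₘ η := by
    refine Measure.ext_prod fun {D} {B} hD hB => ?_
    rw [Measure.compProd_apply_prod hD hB, Measure.map_apply (hX.prodMk hY) (hD.prod hB)]
    have hpre : (fun ω => (X ω, Y ω)) ⁻¹' D ×ˢ B = X ⁻¹' D ∩ Y ⁻¹' B := by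
      ext ω; simp
    rw [hpre, ← lintegral_inter_add_sdiff _ D hA',
      ← measure_inter_add_sdiff (X ⁻¹' D ∩ Y ⁻¹' B) (hX hA')]
    congr 1
    · have h1 : X ⁻¹' D ∩ Y ⁻¹' B ∩ X ⁻¹' A' = X ⁻¹' (D ∩ A') ∩ Y ⁻¹' B := by
        ext ω; simp; tauto
      have hsub : D ∩ A' ⊆ A := fun x hx => hx.2.1
      rw [h1, h _ (hD.inter hA') hsub B hB, hrest _ (hD.inter hA') hsub,
        lintegral_withDensity_eq_lintegral_mul _ hρ (η.measurable_coe hB)]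
      refine setLIntegral_congr_fun (hD.inter hA') fun x hx => ?_
      simp only [Pi.mul_apply]
      rw [hηin x hx.2, Measure.smul_apply, smul_eq_mul, ← mul_assoc,
        ENNReal.mul_inv_cancel hx.2.2.1.ne' hx.2.2.2.ne, one_mul]
    · have h1 : (X ⁻¹' D ∩ Y ⁻¹' B) \ X ⁻¹' A' = X ⁻¹' (D \ A') ∩ Y ⁻¹' B := by
        ext ω; simp; tauto
      rw [h1, setLIntegral_congr_fun (g := fun x => condDistrib Y X P x B) (hD.diff hA')
        (fun x hx => by simp only [hηout x hx.2])]
      rw [setLIntegral_map (hD.diff hA') ((condDistrib Y X P).measurable_coe hB) hX]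
      exact (setLIntegral_preimage_condDistrib hX hY.aemeasurable hB (hD.diff hA')).symm
  filter_upwards [condDistrib_ae_eq_of_measure_eq_compProd X hY.aemeasurable hprod, hfin, hpos]
    with x hx hf hp hxA
  have hxA' : x ∈ A' := ⟨hxA, hp hxA, hf hxA⟩
  exact ⟨hp hxA, hf hxA, by rw [hx, hηin x hxA']⟩

/-! ### The Mecke formula. -/

section Mecke

/-- The Poisson weights satisfy `k p_k = r p_{k-1}`; the rest is a shift of the index. -/
theorem lintegral_natCast_mul_poisson (r : ℝ≥0) (φ : ℝ≥0∞ → ℝ≥0∞) (hφ : Measurable φ) :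
    ∫⁻ x, x * φ x ∂((poissonMeasure r).map (fun k : ℕ => (k : ℝ≥0∞))) =
      r * ∫⁻ x, φ (x + 1) ∂((poissonMeasure r).map (fun k : ℕ => (k : ℝ≥0∞))) := by
  have hc : Measurable (fun k : ℕ => (k : ℝ≥0∞)) := measurable_from_nat
  rw [lintegral_map (measurable_id'.fun_mul hφ) hc,
    lintegral_map (by fun_prop) hc, poissonMeasure,
    lintegral_sum_measure, lintegral_sum_measure]
  simp_rw [lintegral_smul_measure, lintegral_dirac, smul_eq_mul]
  rw [tsum_eq_zero_add' ENNReal.summable, ← ENNReal.tsum_mul_left]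
  simp only [Nat.cast_zero, zero_mul, mul_zero, zero_add]
  refine tsum_congr fun k => ?_
  have hr : (r : ℝ≥0∞) = ENNReal.ofReal r := (ENNReal.ofReal_coe_nnreal).symm
  have hk : ((k + 1 : ℕ) : ℝ≥0∞) = ENNReal.ofReal ((k : ℝ) + 1) := by
    rw [← ENNReal.ofReal_natCast]; push_cast; rfl
  have : ENNReal.ofReal (Real.exp (-r) * (r : ℝ) ^ (k + 1) / ((k + 1).factorial : ℝ)) *
      ((k + 1 : ℕ) : ℝ≥0∞) =
      r * ENNReal.ofReal (Real.exp (-r) * (r : ℝ) ^ k / (k.factorial : ℝ)) := by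
    rw [hr, hk, ← ENNReal.ofReal_mul (by positivity), ← ENNReal.ofReal_mul (by positivity)]
    congr 1
    rw [Nat.factorial_succ]
    push_cast
    field_simp
    ring
  rw [← mul_assoc, this]
  push_cast
  ring

variable {S E : Type*} [MeasurableSpace S] [MeasurableSpace E] {P : Measure S}
  {N : S → Measure E} {ν : Measure E}

theorem IsPoissonRandomMeasure.measurable_apply (hN : IsPoissonRandomMeasure P N ν) {B : Set E}
    (hB : MeasurableSet B) : Measurable (fun ω => N ω B) :=
  (Measure.measurable_coe hB).comp hN.measurable

theorem IsPoissonRandomMeasure.iIndepFun_fintype (hN : IsPoissonRandomMeasure P N ν)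
    {ι : Type*} [Fintype ι] {B : ι → Set E} (hB : ∀ i, MeasurableSet (B i))
    (hd : Pairwise (fun i j => Disjoint (B i) (B j))) :
    iIndepFun (fun i ω => N ω (B i)) P := by
  have h := hN.indep (Fintype.card ι) (fun i => B ((Fintype.equivFin ι).symm i)) (fun i => hB _)
    (fun i j hij => hd ((Fintype.equivFin ι).symm.injective.ne hij))
  exact iIndepFun.of_precomp (g := (Fintype.equivFin ι).symm)
    (f := fun i ω => N ω (B i)) (Fintype.equivFin ι).symm.surjective h

variable [IsProbabilityMeasure P]

/-- The masses of the `D i` are independent of `N C`, so they can be frozen and the Poisson identity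
applied in the variable `N C` alone. -/
theorem mecke_of_disjoint (hN : IsPoissonRandomMeasure P N ν) {ι : Type*} [Fintype ι]
    {C : Set E} (hC : MeasurableSet C) (hνC : ν C < ∞) {D : ι → Set E}
    (hD : ∀ i, MeasurableSet (D i)) (hd : Pairwise (fun i j => Disjoint (D i) (D j)))
    (hCD : ∀ i, Disjoint C (D i)) (φ : ℝ≥0∞ × (ι → ℝ≥0∞) → ℝ≥0∞) (hφ : Measurable φ) :
    ∫⁻ ω, N ω C * φ (N ω C, fun i => N ω (D i)) ∂P =
      ν C * ∫⁻ ω, φ (N ω C + 1, fun i => N ω (D i)) ∂P := by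
  classical
  have hmC := hN.measurable_apply hC
  have hmD : Measurable (fun ω i => N ω (D i)) :=
    measurable_pi_lambda _ fun i => hN.measurable_apply (hD i)
  have hind : IndepFun (fun ω => N ω C) (fun ω i => N ω (D i)) P := by
    -- `C` joins the family under the index `none`; independence of the enlarged family then splits
    -- into the blocks `{none}` and its complement.
    let B : Option ι → Set E := fun o => o.elim C D
    have hB : ∀ o, MeasurableSet (B o) := by rintro (_ | i); exacts [hC, hD i]
    have hBd : Pairwise (fun i j => Disjoint (B i) (B j)) := by
      rintro (_ | i) (_ | j) hij
      · exact absurd rfl hij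
      · exact hCD j
      · exact (hCD i).symm
      · exact hd fun h => hij (by rw [h])
    have h := hN.iIndepFun_fintype hB hBd
    have h2 := h.indepFun_finset {none} (Finset.univ.erase none) (by simp)
      (fun o => hN.measurable_apply (hB o))
    have m1 : Measurable (fun y : ({none} : Finset (Option ι)) → ℝ≥0∞ => y ⟨none, by simp⟩) :=
      measurable_pi_apply _
    have m2 : Measurable (fun (y : ((Finset.univ : Finset (Option ι)).erase none) → ℝ≥0∞) (i : ι) =>
        y ⟨some i, by simp⟩) := measurable_pi_lambda _ fun i => measurable_pi_apply _
    exact h2.comp m1 m2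
  have hmap := (indepFun_iff_map_prod_eq_prod_map_map hmC.aemeasurable hmD.aemeasurable).1 hind
  have hpD : IsProbabilityMeasure (P.map (fun ω i => N ω (D i))) :=
    Measure.isProbabilityMeasure_map hmD.aemeasurable
  have e1 : ∫⁻ ω, N ω C * φ (N ω C, fun i => N ω (D i)) ∂P =
      ∫⁻ z, z.1 * φ z ∂(P.map fun ω => (N ω C, fun i => N ω (D i))) :=
    (lintegral_map (measurable_fst.mul hφ) (hmC.prodMk hmD)).symm
  have e2 : ∫⁻ ω, φ (N ω C + 1, fun i => N ω (D i)) ∂P =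
      ∫⁻ z, φ (z.1 + 1, z.2) ∂(P.map fun ω => (N ω C, fun i => N ω (D i))) :=
    (lintegral_map (hφ.comp ((measurable_fst.add_const 1).prodMk measurable_snd))
      (hmC.prodMk hmD)).symm
  rw [e1, e2, hmap, hN.poisson C hC hνC]
  have hφ' : Measurable (fun z : ℝ≥0∞ × (ι → ℝ≥0∞) => φ (z.1 + 1, z.2)) := by fun_prop
  rw [lintegral_prod_symm' _ (measurable_fst.fun_mul hφ), lintegral_prod_symm' _ hφ',
    ← lintegral_const_mul]
  · refine lintegral_congr fun y => ?_
    have := lintegral_natCast_mul_poisson (ν C).toNNReal (fun x => φ (x, y))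
      (hφ.comp (measurable_id.prodMk measurable_const))
    rw [ENNReal.coe_toNNReal hνC.ne] at this
    exact this
  · exact hφ'.lintegral_prod_left'

omit [MeasurableSpace S] in
theorem setLIntegral_eq_sum_inter {ι : Type*} [Fintype ι] {C : ι → Set E}
    (hC : ∀ i, MeasurableSet (C i)) (hd : Pairwise (fun i j => Disjoint (C i) (C j)))
    (hU : ⋃ i, C i = Set.univ) (m : Measure E) {A : Set E} (hA : MeasurableSet A)
    (g : E → ℝ≥0∞) : ∫⁻ v in A, g v ∂m = ∑ i, ∫⁻ v in A ∩ C i, g v ∂m := by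
  have hA' : A = ⋃ i, A ∩ C i := by rw [← Set.inter_iUnion, hU, Set.inter_univ]
  conv_lhs => rw [hA']
  rw [lintegral_iUnion (fun i => hA.inter (hC i)), tsum_fintype]
  exact fun i j hij => (hd hij).mono Set.inter_subset_right Set.inter_subset_right

/-- Cut `A` along the cells. A point added in `A ∩ C a` raises the mass of the cell `C a` by one and
of no other cell, which reduces each piece to the disjoint case. -/
theorem mecke_of_partition (hN : IsPoissonRandomMeasure P N ν) {ι : Type*} [Fintype ι]
    {A : Set E} (hA : MeasurableSet A) (hνA : ν A < ∞) {C : ι → Set E}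
    (hC : ∀ i, MeasurableSet (C i)) (hd : Pairwise (fun i j => Disjoint (C i) (C j)))
    (hU : ⋃ i, C i = Set.univ) (φ : (ι → ℝ≥0∞) → ℝ≥0∞) (hφ : Measurable φ) :
    ∫⁻ ω, N ω A * φ (fun i => N ω (C i)) ∂P =
      ∫⁻ v in A, ∫⁻ ω, φ (fun i => N ω (C i) + (C i).indicator 1 v) ∂P ∂ν := by
  classical
  have hsum : ∀ ω, N ω A = ∑ a, N ω (A ∩ C a) := fun ω => by
    simpa using setLIntegral_eq_sum_inter hC hd hU (N ω) hA 1
  simp_rw [hsum, Finset.sum_mul]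
  rw [lintegral_finsetSum _ fun a _ => (hN.measurable_apply (hA.inter (hC a))).fun_mul
      (hφ.fun_comp (measurable_pi_lambda _ fun i => hN.measurable_apply (hC i))),
    setLIntegral_eq_sum_inter hC hd hU ν hA]
  refine Finset.sum_congr rfl fun a _ => ?_
  -- Taking `A` out of the cell `a` makes every `D b` disjoint from `A ∩ C a`, while the masses of
  -- all cells can still be recovered from the `D b` and `A ∩ C a`.
  let D : ι → Set E := fun b => if b = a then C a \ A else C b
  have hDC : ∀ b, D b ⊆ C b := by
    intro b
    by_cases hb : b = a
    · subst hb; simp [D]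
    · simp [D, hb]
  have hDA : ∀ b, Disjoint (A ∩ C a) (D b) := by
    intro b
    by_cases hb : b = a
    · subst hb
      simp only [D, if_true]
      exact Set.disjoint_left.2 fun x hx hx' => hx'.2 hx.1
    · simp only [D, if_neg hb]
      exact (hd (Ne.symm hb)).mono_left Set.inter_subset_right
  have hNC : ∀ ω b, N ω (C b) = N ω (D b) + if b = a then N ω (A ∩ C a) else 0 := by
    intro ω b
    by_cases hb : b = a
    · subst hb
      simp only [D, if_true]
      rw [Set.inter_comm, add_comm, measure_inter_add_sdiff _ hA]
    · simp [D, hb]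
  have key := mecke_of_disjoint hN (hA.inter (hC a))
    ((measure_mono Set.inter_subset_left).trans_lt hνA) (D := D)
    (fun b => by
      by_cases hb : b = a
      · simp only [D, hb, if_true]; exact (hC a).diff hA
      · simp only [D, if_neg hb]; exact hC b)
    (fun i j hij => (hd hij).mono (hDC i) (hDC j)) hDA
    (fun z => φ (fun b => z.2 b + if b = a then z.1 else 0))
    (hφ.comp (measurable_pi_lambda _ fun b => by
      by_cases hb : b = a
      · simp only [hb, if_true]
        exact ((measurable_pi_apply a).comp measurable_snd).add measurable_fst
      · simp only [hb, if_false, add_zero]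
        exact (measurable_pi_apply b).comp measurable_snd))
  simp only [← hNC] at key
  rw [key, setLIntegral_congr_fun (g := fun _ => ∫⁻ ω, φ (fun b => N ω (D b) +
    if b = a then N ω (A ∩ C a) + 1 else 0) ∂P) (hA.inter (hC a)), setLIntegral_const, mul_comm]
  intro v hv
  refine lintegral_congr fun ω => congrArg φ (funext fun b => ?_)
  rw [hNC]
  by_cases hb : b = a
  · subst hb
    simp [hv.2, add_assoc]
  · have : v ∉ C b := fun h => Set.disjoint_left.1 (hd hb) h hv.2
    simp [hb, this]

/-- The sets of measures that depend on the masses of the cells of a finite measurable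
partition. -/
def partitionCylinders (E : Type*) [MeasurableSpace E] : Set (Set (Measure E)) :=
  {s | ∃ (ι : Type) (_ : Fintype ι) (C : ι → Set E) (T : Set (ι → ℝ≥0∞)),
    (∀ i, MeasurableSet (C i)) ∧ Pairwise (fun i j => Disjoint (C i) (C j)) ∧
    ⋃ i, C i = Set.univ ∧ MeasurableSet T ∧ s = {m | (fun i => m (C i)) ∈ T}}

-- The common refinement, with cells `C i ∩ D j`, determines the masses of both partitions by
-- summing over rows and columns.
omit [MeasurableSpace S] in
theorem isPiSystem_partitionCylinders : IsPiSystem (partitionCylinders E) := by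
  rintro _ ⟨ι, _, C, T, hC, hd, hU, hT, rfl⟩ _ ⟨κ, _, D, R, hD, hd', hU', hR, rfl⟩ -
  refine ⟨ι × κ, inferInstance, fun z => C z.1 ∩ D z.2,
    {y | (fun i => ∑ j, y (i, j)) ∈ T ∧ (fun j => ∑ i, y (i, j)) ∈ R},
    fun z => (hC _).inter (hD _), ?_, ?_, ?_, ?_⟩
  · rintro ⟨i, j⟩ ⟨i', j'⟩ hij
    by_cases h : i = i'
    · have : j ≠ j' := fun h' => hij (by rw [h, h'])
      exact (hd' this).mono Set.inter_subset_right Set.inter_subset_right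
    · exact (hd h).mono Set.inter_subset_left Set.inter_subset_left
  · refine Set.eq_univ_of_forall fun x => ?_
    obtain ⟨i, hi⟩ := Set.mem_iUnion.1 (hU ▸ Set.mem_univ x : x ∈ ⋃ i, C i)
    obtain ⟨j, hj⟩ := Set.mem_iUnion.1 (hU' ▸ Set.mem_univ x : x ∈ ⋃ i, D i)
    exact Set.mem_iUnion.2 ⟨(i, j), hi, hj⟩
  · have h1 : Measurable fun (y : ι × κ → ℝ≥0∞) i => ∑ j, y (i, j) := by fun_prop
    have h2 : Measurable fun (y : ι × κ → ℝ≥0∞) j => ∑ i, y (i, j) := by fun_prop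
    exact (h1 hT).inter (h2 hR)
  · ext m
    have h1 : ∀ i, m (C i) = ∑ j, m (C i ∩ D j) := fun i => by
      simpa using setLIntegral_eq_sum_inter hD hd' hU' m (hC i) 1
    have h2 : ∀ j, m (D j) = ∑ i, m (C i ∩ D j) := fun j => by
      simpa [Set.inter_comm] using setLIntegral_eq_sum_inter hC hd hU m (hD j) 1
    simp only [Set.mem_inter_iff, Set.mem_ofPred_eq, h1, h2]

-- Evaluation at `B` is already seen by the two-cell partition `{B, Bᶜ}`.
omit [MeasurableSpace S] in
theorem generateFrom_partitionCylinders :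
    (inferInstance : MeasurableSpace (Measure E)) =
      MeasurableSpace.generateFrom (partitionCylinders E) := by
  apply le_antisymm
  · refine iSup₂_le fun B hB => ?_
    rintro _ ⟨T, hT, rfl⟩
    refine MeasurableSpace.measurableSet_generateFrom
      ⟨Bool, inferInstance, fun b => if b then B else Bᶜ, {y | y true ∈ T}, ?_, ?_, ?_, ?_, ?_⟩
    · rintro (_ | _)
      · simpa using hB
      · simpa using hB
    · rintro (_ | _) (_ | _) h
      · exact absurd rfl h
      · simpa using disjoint_compl_left
      · simpa using disjoint_compl_right
      · exact absurd rfl h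
    · ext x; simpa using (em (x ∈ B)).symm
    · exact measurable_pi_apply true hT
    · ext m; simp
  · refine MeasurableSpace.generateFrom_le ?_
    rintro _ ⟨ι, _, C, T, hC, -, -, hT, rfl⟩
    exact (measurable_pi_lambda _ fun i => Measure.measurable_coe (hC i)) hT

omit [IsProbabilityMeasure P] in
theorem measurable_add_dirac (hN : Measurable N) :
    Measurable (fun z : E × S => N z.2 + Measure.dirac z.1) := by
  refine Measure.measurable_of_measurable_coe _ fun B hB => ?_
  simp only [Measure.add_apply, Measure.dirac_apply' _ hB]
  exact (((Measure.measurable_coe hB).comp hN).comp measurable_snd).add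
    ((measurable_one.indicator hB).comp measurable_fst)

/-- Both sides integrate `G` against measures on the space of measures: the law of `N` weighted by
`N A`, and the image of `ν|_A ⊗ P` under adding a Dirac mass. They are finite because `ν A < ∞`, and
they agree on the π-system of partition cylinders. -/
theorem mecke_set (hN : IsPoissonRandomMeasure P N ν) {A : Set E} (hA : MeasurableSet A)
    (hνA : ν A < ∞) (G : Measure E → ℝ≥0∞) (hG : Measurable G) :
    ∫⁻ ω, N ω A * G (N ω) ∂P =
      ∫⁻ v in A, ∫⁻ ω, G (N ω + Measure.dirac v) ∂P ∂ν := by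
  classical
  have hmA := hN.measurable_apply hA
  have hadd := measurable_add_dirac hN.measurable
  have : IsFiniteMeasure (ν.restrict A) := ⟨by simpa using hνA⟩
  let m₁ : Measure (Measure E) := (P.withDensity (fun ω => N ω A)).map N
  let m₂ : Measure (Measure E) :=
    ((ν.restrict A).prod P).map (fun z => N z.2 + Measure.dirac z.1)
  have h₁ : ∀ F : Measure E → ℝ≥0∞, Measurable F →
      ∫⁻ m, F m ∂m₁ = ∫⁻ ω, N ω A * F (N ω) ∂P := fun F hF => by
    rw [lintegral_map hF hN.measurable,
      lintegral_withDensity_eq_lintegral_mul _ hmA (hF.fun_comp hN.measurable)]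
    rfl
  have h₂ : ∀ F : Measure E → ℝ≥0∞, Measurable F →
      ∫⁻ m, F m ∂m₂ = ∫⁻ v in A, ∫⁻ ω, F (N ω + Measure.dirac v) ∂P ∂ν := fun F hF => by
    rw [lintegral_map hF hadd, lintegral_prod _ (hF.fun_comp hadd).aemeasurable]
  have hfin : IsFiniteMeasure m₂ := Measure.isFiniteMeasure_map _ _
  have huniv : ∀ {ι : Type} [Fintype ι] (C : ι → Set E) (T : Set (ι → ℝ≥0∞)),
      (∀ i, MeasurableSet (C i)) → Pairwise (fun i j => Disjoint (C i) (C j)) →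
      ⋃ i, C i = Set.univ → MeasurableSet T →
      m₁ {m | (fun i => m (C i)) ∈ T} = m₂ {m | (fun i => m (C i)) ∈ T} := by
    intro ι _ C T hC hd hU hT
    have hms : MeasurableSet {m : Measure E | (fun i => m (C i)) ∈ T} :=
      (measurable_pi_lambda _ fun i => Measure.measurable_coe (hC i)) hT
    rw [← lintegral_indicator_one hms, ← lintegral_indicator_one hms,
      h₁ _ (measurable_one.indicator hms), h₂ _ (measurable_one.indicator hms)]
    have := mecke_of_partition hN hA hνA hC hd hU (T.indicator 1) (measurable_one.indicator hT)
    simp only [Set.indicator_apply, Set.mem_ofPred_eq, Pi.one_apply, Measure.add_apply,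
      Measure.dirac_apply' _ (hC _)] at this ⊢
    exact this
  have hu : m₂ Set.univ = m₁ Set.univ := by
    have := huniv (ι := Unit) (fun _ => Set.univ) Set.univ (fun _ => MeasurableSet.univ)
      (fun i j h => absurd rfl h) (Set.iUnion_const _) MeasurableSet.univ
    exact this.symm
  have : m₂ = m₁ := by
    refine ext_of_generate_finite _ generateFrom_partitionCylinders
      isPiSystem_partitionCylinders ?_ hu
    rintro _ ⟨ι, _, C, T, hC, hd, hU, hT, rfl⟩
    exact (huniv C T hC hd hU hT).symm
  rw [← h₁ G hG, ← h₂ G hG, this]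

/-- The Mecke formula, for integrands of product form. -/
theorem mecke [SigmaFinite ν] (hN : IsPoissonRandomMeasure P N ν) (h : E → ℝ≥0∞)
    (hh : Measurable h) (G : Measure E → ℝ≥0∞) (hG : Measurable G) :
    ∫⁻ ω, (∫⁻ v, h v ∂(N ω)) * G (N ω) ∂P =
      ∫⁻ v, h v * ∫⁻ ω, G (N ω + Measure.dirac v) ∂P ∂ν := by
  have hGN := hG.fun_comp hN.measurable
  have hadd := hG.fun_comp (measurable_add_dirac hN.measurable)
  have hR : Measurable (fun v => ∫⁻ ω, G (N ω + Measure.dirac v) ∂P) := hadd.lintegral_prod_right'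
  -- With `G` fixed, each side is an integral of `h` against a measure on `E`. These two measures
  -- are compared on subsets of the spanning sets of `ν`, where `mecke_set` applies.
  let m₁ : Measure E := (P.withDensity (fun ω => G (N ω))).bind N
  let m₂ : Measure E := ν.withDensity (fun v => ∫⁻ ω, G (N ω + Measure.dirac v) ∂P)
  have h₁ : ∀ F : E → ℝ≥0∞, Measurable F →
      ∫⁻ v, F v ∂m₁ = ∫⁻ ω, (∫⁻ v, F v ∂(N ω)) * G (N ω) ∂P := fun F hF => by
    rw [Measure.lintegral_bind hN.measurable.aemeasurable hF.aemeasurable,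
      lintegral_withDensity_eq_lintegral_mul _ hGN
        ((Measure.measurable_lintegral hF).fun_comp hN.measurable)]
    simp [mul_comm]
  have heq : m₁ = m₂ := by
    refine Measure.ext_of_iUnion_eq_univ (iUnion_spanningSets ν) fun i => ?_
    ext A hA
    have hAi := hA.inter (measurableSet_spanningSets ν i)
    rw [Measure.restrict_apply hA, Measure.restrict_apply hA, ← lintegral_indicator_one hAi,
      h₁ _ (measurable_one.indicator hAi), withDensity_apply _ hAi, ← mecke_set hN hAi
      ((measure_mono Set.inter_subset_right).trans_lt (measure_spanningSets_lt_top ν i)) G hG]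
    simp_rw [lintegral_indicator_one hAi]
  rw [← h₁ h hh, heq, lintegral_withDensity_eq_lintegral_mul _ hR hh]
  simp [mul_comm]

end Mecke

/-- `e^{-x}` for `x ∈ [0, ∞]`. -/
def negExp (x : ℝ≥0∞) : ℝ≥0∞ := EReal.exp (-(x : EReal))

/-! ### The function `e^{-x}` on `[0, ∞]`. -/

section NegExp

theorem negExp_ofReal {r : ℝ} (hr : 0 ≤ r) :
    negExp (ENNReal.ofReal r) = ENNReal.ofReal (Real.exp (-r)) := by
  rw [negExp, EReal.coe_ennreal_ofReal, max_eq_left hr, ← EReal.coe_neg, EReal.exp_coe]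

theorem negExp_of_ne_top {x : ℝ≥0∞} (hx : x ≠ ∞) :
    negExp x = ENNReal.ofReal (Real.exp (-x.toReal)) := by
  rw [← negExp_ofReal ENNReal.toReal_nonneg, ENNReal.ofReal_toReal hx]

@[simp] theorem negExp_zero : negExp 0 = 1 := by simp [negExp]

@[simp] theorem negExp_top : negExp ∞ = 0 := by simp [negExp]

theorem negExp_add (x y : ℝ≥0∞) : negExp (x + y) = negExp x * negExp y := by
  rw [negExp, negExp, negExp, ← EReal.exp_add, EReal.coe_ennreal_add, EReal.neg_add, sub_eq_add_neg]
  · exact Or.inl (EReal.coe_ennreal_ne_bot x)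
  · exact Or.inr (EReal.coe_ennreal_ne_bot y)

theorem negExp_sum {ι : Type*} (s : Finset ι) (x : ι → ℝ≥0∞) :
    negExp (∑ i ∈ s, x i) = ∏ i ∈ s, negExp (x i) := by
  classical
  induction s using Finset.induction_on with
  | empty => simp
  | insert a s ha ih => rw [Finset.sum_insert ha, Finset.prod_insert ha, negExp_add, ih]

theorem negExp_antitone : Antitone negExp := fun _ _ h =>
  EReal.exp_monotone (EReal.neg_le_neg_iff.2 (EReal.coe_ennreal_le_coe_ennreal_iff.2 h))

theorem negExp_le_one (x : ℝ≥0∞) : negExp x ≤ 1 := by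
  simpa using negExp_antitone (zero_le : 0 ≤ x)

theorem negExp_ne_top (x : ℝ≥0∞) : negExp x ≠ ∞ := ((negExp_le_one x).trans_lt ENNReal.one_lt_top).ne

theorem continuous_negExp : Continuous negExp :=
  ENNReal.continuous_exp.comp (continuous_neg.comp continuous_coe_ennreal_ereal)

@[fun_prop] theorem measurable_negExp : Measurable negExp := negExp_antitone.measurable

theorem one_sub_negExp_eq_zero {x : ℝ≥0∞} (h : 1 - negExp x = 0) : x = 0 := by
  have h1 : 1 ≤ negExp x := tsub_eq_zero_iff_le.1 h
  rw [negExp, EReal.one_le_exp_iff] at h1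
  have : (x : EReal) ≤ 0 := by simpa using EReal.neg_le_neg_iff.2 h1
  exact nonpos_iff_eq_zero.1 (by exact_mod_cast this)

end NegExp

/-- The Poisson generating function at `q = e^{-x}`, by the exponential series. The value `x = ∞` is
allowed: then `q = 0`, and `∞ * 0 = 0` matches `q ^ 0 = 1`. -/
theorem lintegral_negExp_mul_poisson (r : ℝ≥0) (x : ℝ≥0∞) :
    ∫⁻ y, negExp (x * y) ∂((poissonMeasure r).map (fun k : ℕ => (k : ℝ≥0∞))) =
      negExp ((1 - negExp x) * r) := by
  have hc : Measurable (fun k : ℕ => (k : ℝ≥0∞)) := measurable_from_nat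
  have hpow : ∀ k : ℕ, negExp (x * k) = negExp x ^ k := fun k => by
    have := negExp_sum (Finset.range k) (fun _ => x)
    simpa [mul_comm] using this
  rw [lintegral_map (by fun_prop) hc, poissonMeasure, lintegral_sum_measure]
  simp_rw [lintegral_smul_measure, lintegral_dirac, smul_eq_mul, hpow]
  set q : ℝ := (negExp x).toReal with hq
  have hq0 : 0 ≤ q := ENNReal.toReal_nonneg
  have hq1 : q ≤ 1 := by
    simpa using ENNReal.toReal_mono ENNReal.one_ne_top (negExp_le_one x)
  have hqx : negExp x = ENNReal.ofReal q := (ENNReal.ofReal_toReal (negExp_ne_top x)).symm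
  have hterm : ∀ k : ℕ, ENNReal.ofReal (Real.exp (-r) * (r : ℝ) ^ k / (k.factorial : ℝ)) *
      negExp x ^ k = ENNReal.ofReal (Real.exp (-r) * ((r * q) ^ k / (k.factorial : ℝ))) := by
    intro k
    rw [hqx, ← ENNReal.ofReal_pow hq0, ← ENNReal.ofReal_mul (by positivity)]
    congr 1
    rw [mul_pow]; ring
  simp_rw [hterm]
  have hs : HasSum (fun k : ℕ => Real.exp (-r) * ((r * q) ^ k / (k.factorial : ℝ)))
      (Real.exp (-r) * Real.exp (r * q)) := by
    have := NormedSpace.expSeries_div_hasSum_exp (r * q : ℝ)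
    rw [← Real.exp_eq_exp_ℝ] at this
    exact this.mul_left _
  rw [← ENNReal.ofReal_tsum_of_nonneg (fun k => by positivity) hs.summable, hs.tsum_eq,
    ← Real.exp_add]
  have : (1 - negExp x) * r = ENNReal.ofReal ((1 - q) * r) := by
    rw [hqx, ENNReal.ofReal_mul (by linarith), ENNReal.ofReal_sub _ hq0]
    simp
  rw [this, negExp_ofReal (mul_nonneg (by linarith) r.coe_nonneg)]
  congr 2
  ring

/-! ### The Laplace functional and finiteness of integrals. -/

section Laplace

variable {S E : Type*} [MeasurableSpace S] [MeasurableSpace E] {P : Measure S}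
  {N : S → Measure E} {ν : Measure E}

theorem IsPoissonRandomMeasure.measurable_lintegral (hN : IsPoissonRandomMeasure P N ν)
    {g : E → ℝ≥0∞} (hg : Measurable g) : Measurable (fun ω => ∫⁻ v, g v ∂(N ω)) :=
  (Measure.measurable_lintegral hg).comp hN.measurable

/-- The fibers of a simple function are disjoint, so their contributions are independent and the
expectation factors into Poisson transforms. -/
theorem laplace_simpleFunc (hN : IsPoissonRandomMeasure P N ν) (g : SimpleFunc E ℝ≥0∞)
    (hg : ∫⁻ v, (1 - negExp (g v)) ∂ν < ∞) :
    ∫⁻ ω, negExp (∫⁻ v, g v ∂(N ω)) ∂P = negExp (∫⁻ v, (1 - negExp (g v)) ∂ν) := by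
  classical
  have hL : ∫⁻ v, (1 - negExp (g v)) ∂ν =
      ∑ x ∈ g.range, (1 - negExp x) * ν (g ⁻¹' {x}) := by
    rw [← SimpleFunc.map_lintegral (fun x => 1 - negExp x) g, ← SimpleFunc.lintegral_eq_lintegral]
    rfl
  have hind : iIndepFun (fun (x : g.range) ω => N ω (g ⁻¹' {x.1})) P := by
    refine hN.iIndepFun_fintype (fun x => g.measurableSet_fiber _) fun x y hxy => ?_
    refine Set.disjoint_left.2 fun v hv hv' => hxy (Subtype.ext ?_)
    simp only [Set.mem_preimage, Set.mem_singleton_iff] at hv hv'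
    rw [← hv, ← hv']
  have hmeas : ∀ x : ℝ≥0∞, Measurable (fun y : ℝ≥0∞ => negExp (x * y)) := fun x => by fun_prop
  have hprod := lintegral_prod_eq_prod_lintegral_of_indepFun Finset.univ
    (fun (x : g.range) ω => negExp (x.1 * N ω (g ⁻¹' {x.1})))
    (hind.comp (fun x y => negExp (x.1 * y)) (fun x => hmeas x.1))
    (fun x => (hmeas x.1).comp (hN.measurable_apply (g.measurableSet_fiber _)))
  have h1 : ∀ ω, negExp (∫⁻ v, g v ∂(N ω)) =
      ∏ x : g.range, negExp (x.1 * N ω (g ⁻¹' {x.1})) := by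
    intro ω
    rw [SimpleFunc.lintegral_eq_lintegral, SimpleFunc.lintegral, negExp_sum]
    exact (Finset.prod_coe_sort g.range fun x => negExp (x * N ω (g ⁻¹' {x}))).symm
  have := hind.isProbabilityMeasure
  simp_rw [h1]
  rw [hprod, hL, negExp_sum, ← Finset.prod_coe_sort g.range fun x =>
    negExp ((1 - negExp x) * ν (g ⁻¹' {x}))]
  refine Finset.prod_congr rfl fun x _ => ?_
  -- The fiber over zero may have infinite `ν`-mass but contributes a factor one. Over any other
  -- value, `hg` forces the finite mass that the Poisson law requires.
  by_cases hx : x.1 = 0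
  · simp [hx]
  · have hfin : ν (g ⁻¹' {x.1}) < ∞ := by
      rw [hL] at hg
      have h2 := (ENNReal.sum_lt_top.1 hg) x.1 x.2
      by_contra hcon
      rw [not_lt, top_le_iff] at hcon
      rw [hcon, ENNReal.mul_top (fun h => hx (one_sub_negExp_eq_zero h))] at h2
      exact lt_irrefl _ h2
    have h3 : ∫⁻ ω, negExp (x.1 * N ω (g ⁻¹' {x.1})) ∂P =
        ∫⁻ y, negExp (x.1 * y) ∂(P.map fun ω => N ω (g ⁻¹' {x.1})) :=
      (lintegral_map (hmeas x.1) (hN.measurable_apply (g.measurableSet_fiber _))).symm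
    rw [h3, hN.poisson _ (g.measurableSet_fiber _) hfin, lintegral_negExp_mul_poisson,
      ENNReal.coe_toNNReal hfin.ne]

open Filter Topology in
/-- The Laplace functional of a Poisson random measure. -/
theorem laplace_functional [IsProbabilityMeasure P] (hN : IsPoissonRandomMeasure P N ν)
    {g : E → ℝ≥0∞} (hg : Measurable g) (hfin : ∫⁻ v, (1 - negExp (g v)) ∂ν < ∞) :
    ∫⁻ ω, negExp (∫⁻ v, g v ∂(N ω)) ∂P = negExp (∫⁻ v, (1 - negExp (g v)) ∂ν) := by
  have hmono : ∀ v, Monotone fun k => SimpleFunc.eapprox g k v := fun v i j hij =>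
    SimpleFunc.monotone_eapprox g hij v
  have hlim : ∀ v, Tendsto (fun k => SimpleFunc.eapprox g k v) atTop (𝓝 (g v)) := fun v =>
    SimpleFunc.tendsto_eapprox hg v
  have hsub : Antitone fun y : ℝ≥0∞ => 1 - y := fun a b h => tsub_le_tsub_left h 1
  have hsubc : Continuous fun y : ℝ≥0∞ => 1 - negExp y :=
    (ENNReal.continuous_sub_left ENNReal.one_ne_top).comp continuous_negExp
  have hmono' : Monotone fun y : ℝ≥0∞ => 1 - negExp y := fun a b h => hsub (negExp_antitone h)
  -- Simple functions increase to `g`: the exponent converges monotonically, and the expectation by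
  -- domination by the constant one.
  have hL : Tendsto (fun k => ∫⁻ v, (1 - negExp (SimpleFunc.eapprox g k v)) ∂ν) atTop
      (𝓝 (∫⁻ v, (1 - negExp (g v)) ∂ν)) := by
    refine lintegral_tendsto_of_tendsto_of_monotone
      (fun k => (hmono'.measurable.comp (SimpleFunc.measurable _)).aemeasurable)
      (ae_of_all _ fun v i j hij => hmono' (hmono v hij))
      (ae_of_all _ fun v => (hsubc.tendsto _).comp (hlim v))
  have hR : Tendsto (fun k => ∫⁻ ω, negExp (∫⁻ v, SimpleFunc.eapprox g k v ∂(N ω)) ∂P) atTop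
      (𝓝 (∫⁻ ω, negExp (∫⁻ v, g v ∂(N ω)) ∂P)) := by
    refine tendsto_lintegral_of_dominated_convergence (fun _ => 1)
      (fun k => measurable_negExp.comp (hN.measurable_lintegral (SimpleFunc.measurable _)))
      (fun k => ae_of_all _ fun ω => negExp_le_one _) (by simp) (ae_of_all _ fun ω => ?_)
    refine (continuous_negExp.tendsto _).comp ?_
    exact lintegral_tendsto_of_tendsto_of_monotone
      (fun k => (SimpleFunc.measurable _).aemeasurable)
      (ae_of_all _ fun v => hmono v) (ae_of_all _ hlim)
  refine tendsto_nhds_unique hR ?_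
  have heq : ∀ k, ∫⁻ ω, negExp (∫⁻ v, SimpleFunc.eapprox g k v ∂(N ω)) ∂P =
      negExp (∫⁻ v, (1 - negExp (SimpleFunc.eapprox g k v)) ∂ν) := fun k => by
    refine laplace_simpleFunc hN _ (lt_of_le_of_lt (lintegral_mono fun v => ?_) hfin)
    exact hmono' ((hmono v).ge_of_tendsto (hlim v) k)
  simp_rw [heq]
  exact (continuous_negExp.tendsto _).comp hL

-- As `t` decreases to zero, `𝔼 e^{-t N(g)}` tends to the probability that `N(g)` is finite. By the
-- Laplace functional it equals `e^{-Λ(t g)}`, which tends to one by dominated convergence.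
open Filter Topology in
theorem ae_lintegral_lt_top [IsProbabilityMeasure P] (hN : IsPoissonRandomMeasure P N ν)
    {g : E → ℝ≥0} (hg : Measurable g) (hfin : ∫⁻ v, (1 - negExp (g v)) ∂ν < ∞) :
    ∀ᵐ ω ∂P, ∫⁻ v, (g v : ℝ≥0∞) ∂(N ω) < ∞ := by
  have hg' : Measurable fun v => (g v : ℝ≥0∞) := hg.coe_nnreal_ennreal
  have hNg := hN.measurable_lintegral hg'
  let t : ℕ → ℝ≥0∞ := fun k => ((k : ℝ≥0∞) + 1)⁻¹
  have ht0 : ∀ k, t k ≠ 0 := fun k =>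
    ENNReal.inv_ne_zero.2 (ENNReal.add_ne_top.2 ⟨ENNReal.natCast_ne_top k, ENNReal.one_ne_top⟩)
  have ht1 : ∀ k, t k ≤ 1 := fun k => ENNReal.inv_le_one.2 le_add_self
  have ht : Tendsto t atTop (𝓝 0) := by
    have h := (tendsto_add_atTop_iff_nat 1).2 ENNReal.tendsto_inv_nat_nhds_zero
    refine h.congr fun k => ?_
    simp [t]
  have hsubc : Continuous fun y : ℝ≥0∞ => 1 - negExp y :=
    (ENNReal.continuous_sub_left ENNReal.one_ne_top).comp continuous_negExp
  have hmono' : Monotone fun y : ℝ≥0∞ => 1 - negExp y := fun a b h =>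
    tsub_le_tsub_left (negExp_antitone h) 1
  have htx : ∀ x : ℝ≥0∞, x ≠ ∞ → Tendsto (fun k => t k * x) atTop (𝓝 0) := fun x hx => by
    simpa using ENNReal.Tendsto.mul_const ht (Or.inr hx)
  have hle : ∀ k v, 1 - negExp (t k * g v) ≤ 1 - negExp (g v) := fun k v =>
    hmono' (mul_le_of_le_one_left zero_le (ht1 k))
  have hL : Tendsto (fun k => ∫⁻ v, (1 - negExp (t k * g v)) ∂ν) atTop (𝓝 (∫⁻ _, 0 ∂ν)) := by
    refine tendsto_lintegral_of_dominated_convergence (fun v => 1 - negExp (g v))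
      (fun k => hmono'.measurable.comp (hg'.const_mul _)) (fun k => ae_of_all _ (hle k)) hfin.ne
      (ae_of_all _ fun v => ?_)
    have h := (hsubc.tendsto 0).comp (htx (g v) ENNReal.coe_ne_top)
    rwa [negExp_zero, tsub_self] at h
  rw [lintegral_zero] at hL
  have hms : MeasurableSet {ω | ∫⁻ v, (g v : ℝ≥0∞) ∂(N ω) < ∞} :=
    measurableSet_lt hNg measurable_const
  have hR : Tendsto (fun k => ∫⁻ ω, negExp (t k * ∫⁻ v, (g v : ℝ≥0∞) ∂(N ω)) ∂P) atTop
      (𝓝 (∫⁻ ω, {ω | ∫⁻ v, (g v : ℝ≥0∞) ∂(N ω) < ∞}.indicator 1 ω ∂P)) := by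
    refine tendsto_lintegral_of_dominated_convergence (fun _ => 1)
      (fun k => measurable_negExp.comp (hNg.const_mul _))
      (fun k => ae_of_all _ fun ω => negExp_le_one _) (by simp) (ae_of_all _ fun ω => ?_)
    by_cases h : ∫⁻ v, (g v : ℝ≥0∞) ∂(N ω) = ∞
    · rw [Set.indicator_of_notMem (by simp [h]), h]
      refine tendsto_const_nhds.congr fun k => ?_
      rw [ENNReal.mul_top (ht0 k), negExp_top]
    · rw [Set.indicator_of_mem (by simpa [lt_top_iff_ne_top] using h)]
      have h' := (continuous_negExp.tendsto 0).comp (htx _ h)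
      rwa [negExp_zero] at h'
  have heq : ∀ k, ∫⁻ ω, negExp (t k * ∫⁻ v, (g v : ℝ≥0∞) ∂(N ω)) ∂P =
      negExp (∫⁻ v, (1 - negExp (t k * g v)) ∂ν) := fun k => by
    rw [← laplace_functional hN (hg'.const_mul _)
      ((lintegral_mono (hle k)).trans_lt hfin)]
    simp_rw [lintegral_const_mul _ hg']
  simp_rw [heq] at hR
  have h1 := tendsto_nhds_unique hR ((continuous_negExp.tendsto _).comp hL)
  rw [lintegral_indicator_one hms, negExp_zero] at h1
  exact (prob_compl_eq_zero_iff hms).2 h1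

end Laplace

/-! ### The recursion for sums over set partitions. -/

section Partitions

variable {ι : Type*} [DecidableEq ι]

/-- Sort the partitions by the cell `insert a J` that contains `a`; the other cells form an
arbitrary partition of `s \ J`. -/
theorem sum_finpartition_insert {M : Type*} [CommSemiring M] {a : ι} {s : Finset ι} (ha : a ∉ s)
    (F : Finset ι → M) :
    ∑ p : Finpartition (insert a s), ∏ c ∈ p.parts, F c =
      ∑ J ∈ s.powerset, F (insert a J) * ∑ q : Finpartition (s \ J), ∏ c ∈ q.parts, F c := by
  classical
  have hext : ∀ z : (Σ J : Finset ι, Finpartition (s \ J)),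
      z ∈ s.powerset.sigma (fun J => (Finset.univ : Finset (Finpartition (s \ J)))) →
      Disjoint (s \ z.1) (insert a z.1) ∧ s \ z.1 ⊔ insert a z.1 = insert a s := by
    intro z hz
    have hJ : z.1 ⊆ s := by simpa using hz
    constructor
    · rw [Finset.disjoint_left]
      intro x hx hx'
      rw [Finset.mem_sdiff] at hx
      rcases Finset.mem_insert.1 hx' with rfl | h
      · exact ha hx.1
      · exact hx.2 h
    · ext x
      simp only [Finset.sup_eq_union, Finset.mem_union, Finset.mem_sdiff, Finset.mem_insert]
      have := @hJ x
      tauto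
  have hnot : ∀ (J : Finset ι) (q : Finpartition (s \ J)) (c : Finset ι), c ∈ q.parts → a ∉ c :=
    fun J q c hc h => ha (Finset.mem_sdiff.1 (q.le hc h)).1
  simp_rw [Finset.mul_sum]
  rw [Finset.sum_sigma']
  symm
  refine Finset.sum_bij (fun z hz => Finpartition.extend z.2
    (Finset.insert_ne_empty a z.1) (hext z hz).1 (hext z hz).2) ?_ ?_ ?_ ?_
  · exact fun _ _ => Finset.mem_univ _
  · rintro ⟨J, q⟩ hz ⟨J', q'⟩ hz' h
    have hJ : J ⊆ s := by simpa using hz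
    have hJ' : J' ⊆ s := by simpa using hz'
    have hparts : insert (insert a J) q.parts = insert (insert a J') q'.parts :=
      congrArg Finpartition.parts h
    have h1 : insert a J = insert a J' := by
      have : insert a J ∈ insert (insert a J') q'.parts := by
        rw [← hparts]; exact Finset.mem_insert_self _ _
      rcases Finset.mem_insert.1 this with h | h
      · exact h
      · exact absurd (Finset.mem_insert_self a J) (hnot _ _ _ h)
    have h2 : J = J' := by
      rw [← Finset.erase_insert (fun h => ha (hJ h) : a ∉ J), h1,
        Finset.erase_insert (fun h => ha (hJ' h) : a ∉ J')]
    subst h2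
    have h3 : q.parts = q'.parts := by
      have e1 : insert a J ∉ q.parts := fun h => hnot _ _ _ h (Finset.mem_insert_self _ _)
      have e2 : insert a J ∉ q'.parts := fun h => hnot _ _ _ h (Finset.mem_insert_self _ _)
      rw [← Finset.erase_insert e1, hparts, Finset.erase_insert e2]
    rw [Finpartition.ext h3]
  · intro p _
    have has : a ∈ insert a s := Finset.mem_insert_self _ _
    have hap : a ∈ p.part a := p.mem_part has
    have hpm : p.part a ∈ p.parts := p.part_mem.2 has
    have hsup : (p.parts.erase (p.part a)).sup id = s \ (p.part a).erase a := by
      ext x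
      simp only [Finset.mem_sup, id, Finset.mem_erase, Finset.mem_sdiff]
      constructor
      · rintro ⟨c, ⟨hc, hcp⟩, hx⟩
        have hxa : x ∉ p.part a := fun h => hc (p.eq_of_mem_parts hcp hpm hx h)
        have : x ≠ a := fun h => hxa (h ▸ hap)
        exact ⟨(Finset.mem_insert.1 (p.le hcp hx)).resolve_left this, fun h => hxa h.2⟩
      · rintro ⟨hxs, hx⟩
        have hxa : x ≠ a := fun h => ha (h ▸ hxs)
        have hxi : x ∈ insert a s := Finset.mem_insert_of_mem hxs
        refine ⟨p.part x, ⟨fun h => hx ⟨hxa, h ▸ p.mem_part hxi⟩, p.part_mem.2 hxi⟩,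
          p.mem_part hxi⟩
    refine ⟨⟨(p.part a).erase a, p.ofSubset (Finset.erase_subset _ _) hsup⟩, ?_, ?_⟩
    · simp only [Finset.mem_sigma, Finset.mem_powerset, Finset.mem_univ, and_true]
      intro x hx
      rw [Finset.mem_erase] at hx
      exact (Finset.mem_insert.1 (p.part_subset a hx.2)).resolve_left hx.1
    · refine Finpartition.ext ?_
      simp only [Finpartition.extend_parts, Finpartition.ofSubset_parts]
      rw [Finset.insert_erase hap, Finset.insert_erase hpm]
  · rintro ⟨J, q⟩ hz
    rw [Finpartition.extend_parts, Finset.prod_insert]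
    exact fun h => hnot _ _ _ h (Finset.mem_insert_self _ _)

end Partitions

/-! ### Exponentially weighted moments of a Poisson random measure. -/

section Palm

variable {S E : Type*} [MeasurableSpace S] [MeasurableSpace E] {P : Measure S}
  [IsProbabilityMeasure P] {N : S → Measure E} {ν : Measure E} [SigmaFinite ν]

/-- The Mecke formula is applied to the factor with index `a`. Expanding `∏ (h i v + N(h i))` over
subsets gives one term for each set `J` of indices sharing the added point. -/
theorem lintegral_negExp_mul_prod_insert {ι : Type*} [DecidableEq ι]
    (hN : IsPoissonRandomMeasure P N ν) {g : E → ℝ≥0∞} (hg : Measurable g)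
    {h : ι → E → ℝ≥0∞} (hh : ∀ i, Measurable (h i)) {a : ι} {s : Finset ι} (ha : a ∉ s) :
    ∫⁻ ω, negExp (∫⁻ v, g v ∂(N ω)) * ∏ i ∈ insert a s, ∫⁻ v, h i v ∂(N ω) ∂P =
      ∑ J ∈ s.powerset, (∫⁻ v, (∏ i ∈ insert a J, h i v) * negExp (g v) ∂ν) *
        ∫⁻ ω, negExp (∫⁻ v, g v ∂(N ω)) * ∏ i ∈ s \ J, ∫⁻ v, h i v ∂(N ω) ∂P := by
  classical
  have hG : ∀ t : Finset ι, Measurable fun m : Measure E =>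
      negExp (∫⁻ v, g v ∂m) * ∏ i ∈ t, ∫⁻ v, h i v ∂m := fun t =>
    (measurable_negExp.comp (Measure.measurable_lintegral hg)).mul
      (Finset.measurable_prod _ fun i _ => Measure.measurable_lintegral (hh i))
  have hl : ∀ ω, negExp (∫⁻ v, g v ∂(N ω)) * ∏ i ∈ insert a s, ∫⁻ v, h i v ∂(N ω) =
      (∫⁻ v, h a v ∂(N ω)) * (negExp (∫⁻ v, g v ∂(N ω)) * ∏ i ∈ s, ∫⁻ v, h i v ∂(N ω)) := by
    intro ω
    rw [Finset.prod_insert ha]; ring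
  simp_rw [hl]
  rw [mecke hN (h a) (hh a) _ (hG s)]
  have hr : ∀ v, ∫⁻ ω, negExp (∫⁻ v, g v ∂(N ω + Measure.dirac v)) *
        ∏ i ∈ s, ∫⁻ v, h i v ∂(N ω + Measure.dirac v) ∂P =
      ∑ J ∈ s.powerset, (negExp (g v) * ∏ i ∈ J, h i v) *
        ∫⁻ ω, negExp (∫⁻ v, g v ∂(N ω)) * ∏ i ∈ s \ J, ∫⁻ v, h i v ∂(N ω) ∂P := by
    intro v
    have e : ∀ ω, negExp (∫⁻ v, g v ∂(N ω + Measure.dirac v)) *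
        ∏ i ∈ s, ∫⁻ v, h i v ∂(N ω + Measure.dirac v) =
        ∑ J ∈ s.powerset, (negExp (g v) * ∏ i ∈ J, h i v) *
          (negExp (∫⁻ v, g v ∂(N ω)) * ∏ i ∈ s \ J, ∫⁻ v, h i v ∂(N ω)) := by
      intro ω
      simp_rw [lintegral_add_measure, lintegral_dirac' v hg, lintegral_dirac' v (hh _),
        negExp_add, add_comm _ (h _ v)]
      rw [Finset.prod_add, Finset.mul_sum]
      exact Finset.sum_congr rfl fun J _ => by ring
    simp_rw [e]
    rw [lintegral_finsetSum _ fun J _ => ((hG (s \ J)).fun_comp hN.measurable).const_mul _]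
    exact Finset.sum_congr rfl fun J _ =>
      lintegral_const_mul _ ((hG (s \ J)).comp hN.measurable)
  simp_rw [hr, Finset.mul_sum]
  have hm : ∀ J : Finset ι, Measurable fun v => (∏ i ∈ J, h i v) * negExp (g v) := fun J =>
    (Finset.measurable_fun_prod _ fun i _ => hh i).mul (measurable_negExp.comp hg)
  have hrew : ∀ J ∈ s.powerset, ∀ v (c : ℝ≥0∞), h a v * (negExp (g v) * (∏ i ∈ J, h i v) * c) =
      (∏ i ∈ insert a J, h i v) * negExp (g v) * c := by
    intro J hJ v c
    rw [Finset.prod_insert fun h' => ha (Finset.mem_powerset.1 hJ h')]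
    ring
  rw [lintegral_congr fun v => Finset.sum_congr rfl fun J hJ => hrew J hJ v _,
    lintegral_finsetSum _ fun J _ => (hm (insert a J)).mul_const _]
  exact Finset.sum_congr rfl fun J _ => lintegral_mul_const _ (hm (insert a J))

/-- Strong induction on `s`: both sides obey the same recursion in the cell of a chosen element, and
the empty set is the Laplace functional. -/
theorem lintegral_negExp_mul_prod {ι : Type*} [DecidableEq ι]
    (hN : IsPoissonRandomMeasure P N ν) {g : E → ℝ≥0∞} (hg : Measurable g)
    (hfin : ∫⁻ v, (1 - negExp (g v)) ∂ν < ∞)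
    {h : ι → E → ℝ≥0∞} (hh : ∀ i, Measurable (h i)) (s : Finset ι) :
    ∫⁻ ω, negExp (∫⁻ v, g v ∂(N ω)) * ∏ i ∈ s, ∫⁻ v, h i v ∂(N ω) ∂P =
      negExp (∫⁻ v, (1 - negExp (g v)) ∂ν) * ∑ p : Finpartition s, ∏ c ∈ p.parts,
        ∫⁻ v, (∏ i ∈ c, h i v) * negExp (g v) ∂ν := by
  classical
  induction s using Finset.strongInduction with
  | H s ih =>
    rcases s.eq_empty_or_nonempty with rfl | ⟨a, ha⟩
    -- The empty set has exactly one partition, with no cells, hence an empty product.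
    · have : ∑ p : Finpartition (∅ : Finset ι), ∏ c ∈ p.parts,
          ∫⁻ v, (∏ i ∈ c, h i v) * negExp (g v) ∂ν = 1 := by
        rw [show (Finset.univ : Finset (Finpartition (∅ : Finset ι))) =
          {Finpartition.empty (Finset ι)} from
            Finset.eq_singleton_iff_unique_mem.2 ⟨Finset.mem_univ _, fun p _ => by
              refine Finpartition.ext ?_
              rw [p.parts_eq_empty_iff.2 rfl]; rfl⟩]
        rw [Finset.sum_singleton]
        exact Finset.prod_empty
      rw [this, mul_one]
      simpa using laplace_functional hN hg hfin
    · obtain ⟨s, has, rfl⟩ : ∃ t, a ∉ t ∧ insert a t = s :=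
        ⟨s.erase a, Finset.notMem_erase a s, Finset.insert_erase ha⟩
      rw [lintegral_negExp_mul_prod_insert hN hg hh has, sum_finpartition_insert has,
        Finset.mul_sum]
      refine Finset.sum_congr rfl fun J _ => ?_
      rw [ih (s \ J) (lt_of_le_of_lt Finset.sdiff_subset (Finset.ssubset_insert has))]
      ring

omit [SigmaFinite ν] in
theorem prod_cells {n : ℕ} (p : Finpartition (Finset.univ : Finset (Fin n)))
    (F : Fin n → p.parts → ℝ≥0∞) :
    ∏ i, F i ⟨p.part i, p.part_mem.2 (Finset.mem_univ i)⟩ = ∏ c : p.parts, ∏ i ∈ c.1, F i c := by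
  classical
  rw [← Finset.prod_fiberwise (Finset.univ : Finset (Fin n))
    (fun i => (⟨p.part i, p.part_mem.2 (Finset.mem_univ i)⟩ : p.parts))]
  refine Finset.prod_congr rfl fun c _ => ?_
  have hset : Finset.univ.filter (fun i : Fin n =>
      (⟨p.part i, p.part_mem.2 (Finset.mem_univ i)⟩ : p.parts) = c) = c.1 := by
    ext i
    simp only [Finset.mem_filter, Finset.mem_univ, true_and, Subtype.ext_iff]
    exact p.part_eq_iff_mem c.2
  rw [hset]
  refine Finset.prod_congr rfl fun i hi => ?_
  have : (⟨p.part i, p.part_mem.2 (Finset.mem_univ i)⟩ : p.parts) = c :=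
    Subtype.ext (p.part_eq_of_mem c.2 hi)
  rw [this]

omit [MeasurableSpace S] [IsProbabilityMeasure P] [SigmaFinite ν] in
theorem lintegral_momentMeasure_prod {n : ℕ} (ρ : Measure E) [SigmaFinite ρ]
    {h : Fin n → E → ℝ≥0∞} (hh : ∀ i, Measurable (h i)) :
    ∫⁻ v, ∏ i, h i (v i) ∂(momentMeasure n ρ) =
      ∑ p : Finpartition (Finset.univ : Finset (Fin n)), ∏ c ∈ p.parts,
        ∫⁻ v, ∏ i ∈ c, h i v ∂ρ := by
  classical
  rw [momentMeasure, lintegral_finsetSum_measure]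
  refine Finset.sum_congr rfl fun p _ => ?_
  have hm : Measurable (fun v : Fin n → E => ∏ i, h i (v i)) :=
    Finset.measurable_fun_prod _ fun i _ => (hh i).comp (measurable_pi_apply i)
  rw [lintegral_map hm (measurable_pi_lambda _ fun i => measurable_pi_apply _)]
  simp_rw [fun y : p.parts → E => prod_cells p (fun i c => h i (y c))]
  rw [lintegral_pi_prod (fun _ : p.parts => ρ) (fun c v => ∏ i ∈ c.1, h i v)
    fun c => Finset.measurable_fun_prod _ fun i _ => hh i]
  exact Finset.prod_coe_sort p.parts fun c => ∫⁻ v, ∏ i ∈ c, h i v ∂ρ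

/-- Each cell carries one factor `e^{-g}`, which is absorbed into the tilted intensity; the sum over
partitions is then an integral against its moment measure. -/
theorem palm_formula {n : ℕ} (hN : IsPoissonRandomMeasure P N ν) {g : E → ℝ≥0}
    (hg : Measurable g) (hfin : ∫⁻ v, (1 - negExp (g v)) ∂ν < ∞)
    {h : Fin n → E → ℝ≥0∞} (hh : ∀ i, Measurable (h i)) :
    ∫⁻ ω, negExp (∫⁻ v, (g v : ℝ≥0∞) ∂(N ω)) * ∏ i, ∫⁻ v, h i v ∂(N ω) ∂P =
      negExp (∫⁻ v, (1 - negExp (g v)) ∂ν) *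
        ∫⁻ v, ∏ i, h i (v i) ∂(momentMeasure n (tilted ν (fun v => (g v : ℝ)))) := by
  have hg' : Measurable fun v => (g v : ℝ≥0∞) := hg.coe_nnreal_ennreal
  have : SigmaFinite (tilted ν (fun v => (g v : ℝ))) := by
    unfold tilted; infer_instance
  rw [lintegral_negExp_mul_prod hN hg' hfin hh, lintegral_momentMeasure_prod _ hh]
  congr 1
  refine Finset.sum_congr rfl fun p _ => Finset.prod_congr rfl fun c _ => ?_
  rw [tilted, lintegral_withDensity_eq_lintegral_mul _ (by fun_prop)
    (Finset.measurable_fun_prod _ fun i _ => hh i)]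
  refine lintegral_congr fun v => ?_
  rw [negExp_of_ne_top ENNReal.coe_ne_top, Pi.mul_apply, mul_comm]
  rfl

end Palm

/-! ### The Palm formula for the weights `Ω_n`. -/

section Bridge

variable {n : ℕ} {E : Type*} [MeasurableSpace E] {ν : Measure E} {f : Fin n → E → ℝ≥0}

theorem laplaceExponent_coe (ν : Measure E) (g : E → ℝ≥0) :
    laplaceExponent ν (fun v => (g v : ℝ)) = ∫⁻ v, (1 - negExp (g v)) ∂ν := by
  refine lintegral_congr fun v => ?_
  rw [negExp_of_ne_top ENNReal.coe_ne_top, ENNReal.coe_toReal,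
    ENNReal.ofReal_sub _ (Real.exp_nonneg _), ENNReal.ofReal_one]

theorem expNegLaplace_eq_negExp {g : E → ℝ} (h : laplaceExponent ν g < ∞) :
    expNegLaplace ν g = negExp (laplaceExponent ν g) :=
  (negExp_of_ne_top h.ne).symm

/-- `Ω_n` as a function with values in `[0, ∞)`. -/
def bigOmegaNN (f : Fin n → E → ℝ≥0) (w : Fin n → ℝ) (v : E) : ℝ≥0 :=
  ∑ i, (w i).toNNReal * f i v

omit [MeasurableSpace E] in
theorem bigOmega_eq_coe {w : Fin n → ℝ} (hw : ∀ i, 0 ≤ w i) :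
    bigOmega f w = fun v => (bigOmegaNN f w v : ℝ) := by
  funext v
  simp [bigOmega, bigOmegaNN, Real.coe_toNNReal _ (hw _)]

theorem measurable_bigOmegaNN (hf : ∀ i, Measurable (f i)) (w : Fin n → ℝ) :
    Measurable (bigOmegaNN f w) :=
  Finset.measurable_fun_sum _ fun i _ => (hf i).const_mul _

theorem measurable_bigOmega (hf : ∀ i, Measurable (f i)) :
    Measurable (fun z : (Fin n → ℝ) × E => bigOmega f z.1 z.2) := by
  unfold bigOmega
  have := fun i => (hf i).coe_nnreal_real
  fun_prop

theorem lintegral_bigOmegaNN (hf : ∀ i, Measurable (f i)) (w : Fin n → ℝ) (m : Measure E) :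
    ∫⁻ v, (bigOmegaNN f w v : ℝ≥0∞) ∂m =
      ∑ i, ENNReal.ofReal (w i) * ∫⁻ v, (f i v : ℝ≥0∞) ∂m := by
  have h : ∀ i, Measurable fun v => (f i v : ℝ≥0∞) := fun i => (hf i).coe_nnreal_ennreal
  simp_rw [bigOmegaNN, ENNReal.ofNNReal_finsetSum, ENNReal.coe_mul]
  rw [lintegral_finsetSum _ fun i _ => (h i).const_mul _]
  exact Finset.sum_congr rfl fun i _ => lintegral_const_mul _ (h i)

theorem measurable_laplaceExponent [SFinite ν] (hf : ∀ i, Measurable (f i)) :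
    Measurable (fun w : Fin n → ℝ => laplaceExponent ν (bigOmega f w)) := by
  have := measurable_bigOmega hf
  have h : Measurable (fun z : (Fin n → ℝ) × E =>
    ENNReal.ofReal (1 - Real.exp (-bigOmega f z.1 z.2))) := by fun_prop
  exact h.lintegral_prod_right'

theorem measurable_expNegLaplace [SFinite ν] (hf : ∀ i, Measurable (f i)) :
    Measurable (fun w : Fin n → ℝ => expNegLaplace ν (bigOmega f w)) := by
  have := measurable_laplaceExponent (ν := ν) hf
  unfold expNegLaplace
  fun_prop

theorem measurable_prod_coe (hf : ∀ i, Measurable (f i)) :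
    Measurable (fun v : Fin n → E => ∏ i, (f i (v i) : ℝ≥0∞)) :=
  Finset.measurable_fun_prod _ fun i _ =>
    (hf i).coe_nnreal_ennreal.comp (measurable_pi_apply i)

theorem weightedMoment_pi (w : Fin n → ℝ) {B : Fin n → Set E}
    (hB : ∀ i, MeasurableSet (B i)) :
    weightedMoment ν f w (Set.univ.pi B) =
      ∫⁻ v, ∏ i, (B i).indicator (fun u => (f i u : ℝ≥0∞)) (v i)
        ∂(momentMeasure n (tilted ν (bigOmega f w))) := by
  have hBm := MeasurableSet.univ_pi hB
  rw [weightedMoment, withDensity_apply _ hBm, ← lintegral_indicator hBm]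
  exact lintegral_congr fun v => (prod_indicator B (fun i u => (f i u : ℝ≥0∞)) v).symm

variable {S : Type*} [MeasurableSpace S] {P : Measure S} [IsProbabilityMeasure P]
  {N : S → Measure E} [SigmaFinite ν]

/-- The case `g = Ω_n` and `h_i = f_i 1_{B_i}`. Products of indicators test the weighted moment
measure on boxes, which is enough to determine the joint law later. -/
theorem palm_formula_weights (hN : IsPoissonRandomMeasure P N ν) (hf : ∀ i, Measurable (f i))
    {w : Fin n → ℝ} (hw : ∀ i, 0 ≤ w i) (hΛ : laplaceExponent ν (bigOmega f w) < ∞)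
    {B : Fin n → Set E} (hB : ∀ i, MeasurableSet (B i)) :
    ∫⁻ ω, ∏ i, (negExp (ENNReal.ofReal (w i) * tau f N ω i) *
        ∫⁻ v in B i, (f i v : ℝ≥0∞) ∂(N ω)) ∂P =
      expNegLaplace ν (bigOmega f w) * weightedMoment ν f w (Set.univ.pi B) := by
  have hm : ∀ i, Measurable ((B i).indicator (fun u => (f i u : ℝ≥0∞))) := fun i =>
    (hf i).coe_nnreal_ennreal.indicator (hB i)
  rw [expNegLaplace_eq_negExp hΛ]
  rw [bigOmega_eq_coe hw, laplaceExponent_coe] at hΛ ⊢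
  rw [weightedMoment_pi w hB, bigOmega_eq_coe hw,
    ← palm_formula hN (measurable_bigOmegaNN hf w) hΛ hm]
  refine lintegral_congr fun ω => ?_
  rw [lintegral_bigOmegaNN hf, negExp_sum, Finset.prod_mul_distrib]
  simp_rw [lintegral_indicator (hB _)]
  rfl

omit [SigmaFinite ν] in
theorem ae_tau_lt_top (hN : IsPoissonRandomMeasure P N ν) (hf : ∀ i, Measurable (f i))
    (hΛ : ∀ w : Fin n → ℝ, (∀ i, 0 ≤ w i) → laplaceExponent ν (bigOmega f w) < ∞) :
    ∀ᵐ ω ∂P, ∀ i, tau f N ω i < ∞ := by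
  rw [ae_all_iff]
  intro i
  -- A unit weight at `i` alone turns `Ω_n` into `f_i`.
  have h1 := hΛ (Pi.single i 1) fun j => by
    by_cases h : j = i
    · subst h; simp
    · simp [h]
  have h2 : bigOmega f (Pi.single i 1) = fun v => (f i v : ℝ) := by
    funext v
    rw [bigOmega, Finset.sum_eq_single i]
    · simp
    · intro j _ hj; simp [hj]
    · simp
  rw [h2, laplaceExponent_coe] at h1
  exact ae_lintegral_lt_top hN (hf i) h1

end Bridge

/-! ### Dependence of the weighted moment measure on `w`. -/

section MomentKernel

variable {n : ℕ} {E : Type*} [MeasurableSpace E] (ν : Measure E) [SigmaFinite ν]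
  (f : Fin n → E → ℝ≥0)

/-- The point of `E^n` that is constant on the cells of `p`, with values `y`. -/
def spread (p : Finpartition (Finset.univ : Finset (Fin n))) (y : p.parts → E) (i : Fin n) : E :=
  y ⟨p.part i, p.part_mem.2 (Finset.mem_univ i)⟩

theorem measurable_spread (p : Finpartition (Finset.univ : Finset (Fin n))) :
    Measurable (spread p : (p.parts → E) → Fin n → E) :=
  measurable_pi_lambda _ fun _ => measurable_pi_apply _

/-- The density of the part of `weightedMoment ν f w` that belongs to the partition `p`. -/
def cellDensity (p : Finpartition (Finset.univ : Finset (Fin n))) (w : Fin n → ℝ)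
    (y : p.parts → E) : ℝ≥0∞ :=
  (∏ c, ENNReal.ofReal (Real.exp (-bigOmega f w (y c)))) * ∏ i, (f i (spread p y i) : ℝ≥0∞)

variable {f}

theorem measurable_cellDensity (hf : ∀ i, Measurable (f i))
    (p : Finpartition (Finset.univ : Finset (Fin n))) :
    Measurable (Function.uncurry (cellDensity f p)) := by
  have h1 : ∀ c : p.parts, Measurable (fun z : (Fin n → ℝ) × (p.parts → E) =>
      bigOmega f z.1 (z.2 c)) := fun c =>
    (measurable_bigOmega hf).comp (measurable_fst.prodMk
      ((measurable_pi_apply c).comp measurable_snd))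
  have h2 : Measurable (fun z : (Fin n → ℝ) × (p.parts → E) =>
      ∏ i, (f i (spread p z.2 i) : ℝ≥0∞)) :=
    (measurable_prod_coe hf).comp ((measurable_spread p).comp measurable_snd)
  exact (Finset.measurable_fun_prod _ fun c _ =>
    ENNReal.measurable_ofReal.comp (Real.measurable_exp.comp (h1 c).neg)).mul h2

omit [MeasurableSpace E] in
theorem cellDensity_ne_top (p : Finpartition (Finset.univ : Finset (Fin n))) (w : Fin n → ℝ)
    (y : p.parts → E) : cellDensity f p w y ≠ ∞ :=
  ENNReal.mul_ne_top (ENNReal.prod_ne_top fun _ _ => ENNReal.ofReal_ne_top)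
    (ENNReal.prod_ne_top fun _ _ => ENNReal.coe_ne_top)

/-- Pulling the tilt out of the product measures leaves reference measures that do not involve `w`.
Measurability in `w` is thereby reduced to that of `cellDensity`. -/
theorem weightedMoment_eq_sum (hf : ∀ i, Measurable (f i)) (w : Fin n → ℝ) :
    weightedMoment ν f w = ∑ p : Finpartition (Finset.univ : Finset (Fin n)),
      ((Measure.pi (fun _ : p.parts => ν)).withDensity (cellDensity f p w)).map (spread p) := by
  have hΩ : Measurable (bigOmega f w) := (measurable_bigOmega hf).comp measurable_prodMk_left
  have hfm := measurable_prod_coe hf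
  ext A hA
  rw [weightedMoment, withDensity_apply _ hA, momentMeasure, ← lintegral_indicator hA,
    lintegral_finsetSum_measure, Measure.finsetSum_apply]
  refine Finset.sum_congr rfl fun p _ => ?_
  rw [Measure.map_apply (measurable_spread p) hA, withDensity_apply _ (measurable_spread p hA)]
  have : SigmaFinite (ν.withDensity fun v => ENNReal.ofReal (Real.exp (-bigOmega f w v))) :=
    inferInstance
  rw [lintegral_indicator hA]
  change ∫⁻ v in A, _ ∂(Measure.map (spread p) _) = _
  rw [setLIntegral_map hA hfm (measurable_spread p)]
  unfold tilted
  rw [pi_withDensity (fun _ : p.parts => ν) _ fun _ => by fun_prop,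
    setLIntegral_withDensity_eq_setLIntegral_mul _ _ (hfm.fun_comp (measurable_spread p))
      (measurable_spread p hA)]
  · rfl
  · exact Finset.measurable_fun_prod _ fun c _ => ENNReal.measurable_ofReal.comp
      (Real.measurable_exp.comp (hΩ.comp (measurable_pi_apply c)).neg)

/-- `w ↦ weightedMoment ν f w` as a kernel. -/
theorem exists_weightedMoment_kernel (hf : ∀ i, Measurable (f i)) :
    ∃ K : Kernel (Fin n → ℝ) (Fin n → E), IsSFiniteKernel K ∧ ∀ w, K w = weightedMoment ν f w := by
  have hk : ∀ p : Finpartition (Finset.univ : Finset (Fin n)),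
      IsSFiniteKernel (Kernel.withDensity
        (Kernel.const (Fin n → ℝ) (Measure.pi (fun _ : p.parts => ν))) (cellDensity f p)) :=
    fun p => Kernel.IsSFiniteKernel.withDensity _ (cellDensity_ne_top p)
  refine ⟨Kernel.sum fun p : Finpartition (Finset.univ : Finset (Fin n)) =>
    Kernel.map (Kernel.withDensity
      (Kernel.const (Fin n → ℝ) (Measure.pi (fun _ : p.parts => ν))) (cellDensity f p))
      (spread p), inferInstance, fun w => ?_⟩
  rw [weightedMoment_eq_sum ν hf, Kernel.sum_apply, Measure.sum_fintype]
  refine Finset.sum_congr rfl fun p _ => ?_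
  rw [Kernel.map_apply _ (measurable_spread p),
    Kernel.withDensity_apply _ (measurable_cellDensity hf p), Kernel.const_apply]

end MomentKernel

/-! ### Passing from `(Z, ε)` to `(W, X)`. -/

section ChangeOfVariables

variable {n : ℕ}

theorem orthantVolume_eq_pi (n : ℕ) :
    orthantVolume n = Measure.pi (fun _ : Fin n => (volume : Measure ℝ).restrict (Set.Ioi 0)) := by
  rw [← Measure.restrict_pi_pi, orthantVolume, volume_pi]
  congr 1
  ext w; simp

theorem measurableSet_orthant (n : ℕ) : MeasurableSet {w : Fin n → ℝ | ∀ i, 0 < w i} := by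
  have : {w : Fin n → ℝ | ∀ i, 0 < w i} = Set.univ.pi fun _ => Set.Ioi 0 := by ext; simp
  rw [this]
  exact MeasurableSet.univ_pi fun _ => measurableSet_Ioi

theorem ae_orthantVolume_pos (n : ℕ) : ∀ᵐ w ∂(orthantVolume n), ∀ i, 0 < w i :=
  ae_restrict_mem (measurableSet_orthant n)

instance : SigmaFinite (orthantVolume n) := by
  unfold orthantVolume; infer_instance

/-- A gamma law of shape one is exponential; the substitution `z = t w` contributes the Jacobian
`t`. -/
theorem map_div_gammaMeasure {t : ℝ} (ht : 0 < t) :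
    (gammaMeasure 1 1).map (fun z => z / t) =
      (volume.restrict (Set.Ioi 0)).withDensity
        (fun w => ENNReal.ofReal (Real.exp (-(w * t)) * t)) := by
  have hdiv : Measurable (fun z : ℝ => z / t) := measurable_id.div_const t
  have hpdf : Measurable (gammaPDF 1 1) := (measurable_gammaPDFReal 1 1).ennreal_ofReal
  have hdens : Measurable fun w : ℝ => ENNReal.ofReal (Real.exp (-(w * t)) * t) := by fun_prop
  refine Measure.ext_of_lintegral _ fun F hF => ?_
  rw [lintegral_map hF hdiv, gammaMeasure,
    lintegral_withDensity_eq_lintegral_mul _ hpdf (hF.fun_comp hdiv),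
    lintegral_withDensity_eq_lintegral_mul _ hdens hF,
    ← Real.smul_map_volume_mul_left ht.ne', lintegral_smul_measure,
    lintegral_map (hpdf.mul (hF.fun_comp hdiv)) (measurable_const_mul t),
    Real.smul_map_volume_mul_left ht.ne', smul_eq_mul, ← lintegral_const_mul,
    ← lintegral_indicator measurableSet_Ioi]
  · refine lintegral_congr_ae ?_
    -- The two densities may differ at zero: the gamma density need not vanish there, whereas the
    -- half-line is open.
    have h0 : ∀ᵐ w : ℝ, w ≠ 0 := by simp [ae_iff]
    filter_upwards [h0] with w hw
    simp only [Pi.mul_apply]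
    rcases lt_or_gt_of_ne hw with h | h
    · rw [Set.indicator_of_notMem (by simpa using h.le),
        gammaPDF_of_neg (mul_neg_of_pos_of_neg ht h)]
      simp
    · rw [Set.indicator_of_mem (by simpa using h), gammaPDF_of_nonneg (by positivity),
        mul_div_cancel_left₀ _ ht.ne', ← mul_assoc, ← ENNReal.ofReal_mul (abs_nonneg t),
        abs_of_pos ht]
      congr 2
      simp [mul_comm]
  · exact ((hpdf.mul (hF.fun_comp hdiv))).comp (measurable_const_mul t)

theorem map_div_pi_gammaMeasure {t : Fin n → ℝ} (ht : ∀ i, 0 < t i) :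
    (Measure.pi (fun _ : Fin n => gammaMeasure 1 1)).map (fun z i => z i / t i) =
      (orthantVolume n).withDensity
        (fun w => ∏ i, ENNReal.ofReal (Real.exp (-(w i * t i)) * t i)) := by
  have := isProbabilityMeasure_gammaMeasure (one_pos : (0 : ℝ) < 1) (one_pos : (0 : ℝ) < 1)
  have hp : ∀ i, IsProbabilityMeasure ((gammaMeasure 1 1).map (fun z : ℝ => z / t i)) :=
    fun i => Measure.isProbabilityMeasure_map (measurable_id.div_const _).aemeasurable
  rw [Measure.pi_map_pi (μ := fun _ : Fin n => gammaMeasure 1 1) (f := fun i z => z / t i)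
    fun i => (measurable_id.div_const _).aemeasurable]
  simp_rw [map_div_gammaMeasure (ht _)]
  rw [orthantVolume_eq_pi, pi_withDensity (fun _ : Fin n => volume.restrict (Set.Ioi (0 : ℝ)))
    (fun i w => ENNReal.ofReal (Real.exp (-(w * t i)) * t i)) fun i => by fun_prop]

theorem measurable_normalFactor (m β : ℝ) :
    Measurable (fun z : (Fin n → ℝ) × (Fin n → ℝ) => normalFactor m β z.1 z.2) := by
  unfold normalFactor gaussianPDF gaussianPDFReal
  fun_prop

theorem map_affine_pi_gaussianReal (m β : ℝ) {w : Fin n → ℝ} (hw : ∀ i, 0 < w i) :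
    (Measure.pi (fun _ : Fin n => gaussianReal 0 1)).map
        (fun e i => m + (w i)⁻¹ * β + √((w i)⁻¹) * e i) =
      volume.withDensity (fun x => normalFactor m β x w) := by
  have h1 : ∀ i, (gaussianReal 0 1).map (fun e : ℝ => m + (w i)⁻¹ * β + √((w i)⁻¹) * e) =
      volume.withDensity (gaussianPDF (m + β * (w i)⁻¹) (Real.toNNReal (w i)⁻¹)) := by
    intro i
    have hi := hw i
    have hv : Real.toNNReal (w i)⁻¹ ≠ 0 := by
      rw [Ne, Real.toNNReal_eq_zero, not_le]; positivity
    have hcomp : (fun e : ℝ => m + (w i)⁻¹ * β + √((w i)⁻¹) * e) =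
        (fun y => m + (w i)⁻¹ * β + y) ∘ (fun e => √((w i)⁻¹) * e) := rfl
    rw [hcomp, ← Measure.map_map (measurable_const_add _) (measurable_const_mul _),
      gaussianReal_map_const_mul, gaussianReal_map_const_add, ← gaussianReal_of_var_ne_zero _ hv]
    congr 1
    · ring
    · ext
      simp [hi.le]
  have hp : ∀ i, IsProbabilityMeasure ((gaussianReal 0 1).map
      (fun e : ℝ => m + (w i)⁻¹ * β + √((w i)⁻¹) * e)) :=
    fun i => Measure.isProbabilityMeasure_map (by fun_prop)
  rw [Measure.pi_map_pi (μ := fun _ : Fin n => gaussianReal 0 1)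
    (f := fun i e => m + (w i)⁻¹ * β + √((w i)⁻¹) * e) fun i => by fun_prop]
  have hs : ∀ i, SigmaFinite ((volume : Measure ℝ).withDensity
      (gaussianPDF (m + β * (w i)⁻¹) (Real.toNNReal (w i)⁻¹))) := fun i => by
    rw [← h1]; infer_instance
  simp_rw [h1]
  rw [volume_pi, pi_withDensity (fun _ : Fin n => (volume : Measure ℝ)) _
    fun i => measurable_gaussianPDF _ _]
  rfl

theorem lintegral_affine_gaussian (m β : ℝ) {w : Fin n → ℝ} (hw : ∀ i, 0 < w i)
    {F : (Fin n → ℝ) → ℝ≥0∞} (hF : Measurable F) :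
    ∫⁻ e, F (fun i => m + (w i)⁻¹ * β + √((w i)⁻¹) * e i)
        ∂(Measure.pi (fun _ : Fin n => gaussianReal 0 1)) =
      ∫⁻ x, normalFactor m β x w * F x := by
  have hnf : Measurable fun x => normalFactor m β x w :=
    Measurable.comp (f := fun x : Fin n → ℝ => (x, w)) (measurable_normalFactor m β)
      measurable_prodMk_right
  have haff : Measurable fun (e : Fin n → ℝ) i => m + (w i)⁻¹ * β + √((w i)⁻¹) * e i := by fun_prop
  rw [← lintegral_map hF haff, map_affine_pi_gaussianReal m β hw,
    lintegral_withDensity_eq_lintegral_mul _ hnf hF]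
  simp only [Pi.mul_apply]

/-- The return depends on `z` only through `w = z / t`, because `t / z = w⁻¹`. So one may first
change `z` to `w`, and then, for fixed `w`, the noise `e` to `x`. -/
theorem lintegral_gamma_gaussian (m β : ℝ) {t : Fin n → ℝ} (ht : ∀ i, 0 < t i)
    {G : (Fin n → ℝ) × (Fin n → ℝ) → ℝ≥0∞} (hG : Measurable G) :
    ∫⁻ z, ∫⁻ e, G (fun i => z i / t i, fun i => m + t i / z i * β + √(t i / z i) * e i)
        ∂(Measure.pi (fun _ : Fin n => gaussianReal 0 1))
        ∂(Measure.pi (fun _ : Fin n => gammaMeasure 1 1)) =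
      ∫⁻ w, (∏ i, ENNReal.ofReal (Real.exp (-(w i * t i)) * t i)) *
        (∫⁻ x, normalFactor m β x w * G (w, x)) ∂(orthantVolume n) := by
  obtain ⟨H, hHdef⟩ : ∃ H : (Fin n → ℝ) → ℝ≥0∞, ∀ w, H w =
      ∫⁻ e, G (w, fun i => m + (w i)⁻¹ * β + √((w i)⁻¹) * e i)
        ∂(Measure.pi (fun _ : Fin n => gaussianReal 0 1)) := ⟨_, fun _ => rfl⟩
  have hH : Measurable H := by
    rw [funext hHdef]
    refine Measurable.lintegral_prod_right'
      (f := fun z : (Fin n → ℝ) × (Fin n → ℝ) =>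
        G (z.1, fun i => m + (z.1 i)⁻¹ * β + √((z.1 i)⁻¹) * z.2 i)) ?_
    fun_prop
  have hmap : Measurable fun (z : Fin n → ℝ) i => z i / t i := by fun_prop
  have hdens : Measurable fun w : Fin n → ℝ =>
      ∏ i, ENNReal.ofReal (Real.exp (-(w i * t i)) * t i) := by fun_prop
  have e1 : ∀ z : Fin n → ℝ,
      ∫⁻ e, G (fun i => z i / t i, fun i => m + t i / z i * β + √(t i / z i) * e i)
        ∂(Measure.pi (fun _ : Fin n => gaussianReal 0 1)) = H fun i => z i / t i := by
    intro z
    simp only [hHdef, inv_div]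
  simp_rw [e1]
  rw [← lintegral_map hH hmap, map_div_pi_gammaMeasure ht,
    lintegral_withDensity_eq_lintegral_mul _ hdens hH]
  refine lintegral_congr_ae ?_
  filter_upwards [ae_orthantVolume_pos n] with w hw
  rw [Pi.mul_apply, hHdef,
    lintegral_affine_gaussian m β hw (F := fun x => G (w, x))
      (hG.comp measurable_prodMk_left)]

end ChangeOfVariables

/-! ### The joint law of `(W, X, V)` where all `τ_i` are positive. -/

section JointLaw

variable {n : ℕ} {S E : Type*} [MeasurableSpace S] [MeasurableSpace E]
  {P : Measure S} [IsProbabilityMeasure P] {ν : Measure E} {f : Fin n → E → ℝ≥0}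
  {N : S → Measure E} {Z ε : S → Fin n → ℝ} {V : S → Fin n → E}

omit [MeasurableSpace S] in
theorem measurable_tau_id (hf : ∀ i, Measurable (f i)) (i : Fin n) :
    Measurable (fun μ : Measure E => tau f id μ i) :=
  Measure.measurable_lintegral (hf i).coe_nnreal_ennreal

omit [IsProbabilityMeasure P] in
theorem measurable_tau (hf : ∀ i, Measurable (f i)) (hN : Measurable N) (i : Fin n) :
    Measurable (fun ω => tau f N ω i) :=
  (measurable_tau_id hf i).comp hN

theorem measurable_setLIntegral_coe {g : E → ℝ≥0} (hg : Measurable g) {B : Set E}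
    (hB : MeasurableSet B) : Measurable (fun μ : Measure E => ∫⁻ v in B, (g v : ℝ≥0∞) ∂μ) := by
  simp_rw [← lintegral_indicator hB]
  exact Measure.measurable_lintegral (hg.coe_nnreal_ennreal.indicator hB)

theorem measurable_latentW_triple (hf : ∀ i, Measurable (f i)) :
    Measurable (fun p : Measure E × (Fin n → ℝ) × (Fin n → ℝ) =>
      latentW f Prod.fst (fun q => q.2.1) p) := by
  have h := fun i => measurable_tau hf (measurable_fst :
    Measurable (Prod.fst : Measure E × (Fin n → ℝ) × (Fin n → ℝ) → Measure E)) i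
  unfold latentW
  fun_prop

theorem measurable_returns_triple (m β : ℝ) (hf : ∀ i, Measurable (f i)) :
    Measurable (fun p : Measure E × (Fin n → ℝ) × (Fin n → ℝ) =>
      returns m β f Prod.fst (fun q => q.2.1) (fun q => q.2.2) p) := by
  have h := fun i => measurable_tau hf (measurable_fst :
    Measurable (Prod.fst : Measure E × (Fin n → ℝ) × (Fin n → ℝ) → Measure E)) i
  unfold returns
  fun_prop

omit [IsProbabilityMeasure P] in
theorem IsModel.measurable_triple (hM : IsModel P ν f N Z ε V) :
    Measurable (fun ω => (N ω, Z ω, ε ω)) :=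
  hM.poisson.measurable.prodMk (hM.measurable_Z.prodMk hM.measurable_ε)

omit [IsProbabilityMeasure P] in
theorem IsModel.measurable_latentW (hM : IsModel P ν f N Z ε V) (hf : ∀ i, Measurable (f i)) :
    Measurable (latentW f N Z) :=
  (measurable_latentW_triple hf).comp hM.measurable_triple

omit [IsProbabilityMeasure P] in
theorem IsModel.measurable_returns (hM : IsModel P ν f N Z ε V) (hf : ∀ i, Measurable (f i))
    (m β : ℝ) : Measurable (returns m β f N Z ε) :=
  (measurable_returns_triple m β hf).comp hM.measurable_triple

theorem IsModel.lintegral_triple (hM : IsModel P ν f N Z ε V)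
    {Ψ : Measure E × (Fin n → ℝ) × (Fin n → ℝ) → ℝ≥0∞} (hΨ : Measurable Ψ) :
    ∫⁻ ω, Ψ (N ω, Z ω, ε ω) ∂P = ∫⁻ ω, ∫⁻ z, ∫⁻ e, Ψ (N ω, z, e)
      ∂(Measure.pi (fun _ : Fin n => gaussianReal 0 1))
      ∂(Measure.pi (fun _ : Fin n => gammaMeasure 1 1)) ∂P := by
  have := isProbabilityMeasure_gammaMeasure (one_pos : (0 : ℝ) < 1) (one_pos : (0 : ℝ) < 1)
  have hN := hM.poisson.measurable
  have h1 := (indepFun_iff_map_prod_eq_prod_map_map (hN.prodMk hM.measurable_Z).aemeasurable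
    hM.measurable_ε.aemeasurable).1 hM.indep_ε
  rw [(indepFun_iff_map_prod_eq_prod_map_map hN.aemeasurable
    hM.measurable_Z.aemeasurable).1 hM.indep_Z, hM.law_Z, hM.law_ε] at h1
  have hPN : IsProbabilityMeasure (P.map N) := Measure.isProbabilityMeasure_map hN.aemeasurable
  let Φ : (Measure E × (Fin n → ℝ)) × (Fin n → ℝ) → ℝ≥0∞ := fun q => Ψ (q.1.1, q.1.2, q.2)
  have hΦ : Measurable Φ := hΨ.comp ((measurable_fst.comp measurable_fst).prodMk
    ((measurable_snd.comp measurable_fst).prodMk measurable_snd))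
  have e1 : ∫⁻ ω, Ψ (N ω, Z ω, ε ω) ∂P =
      ∫⁻ q, Φ q ∂(P.map fun ω => ((N ω, Z ω), ε ω)) :=
    (lintegral_map hΦ ((hN.prodMk hM.measurable_Z).prodMk hM.measurable_ε)).symm
  have h2 : Measurable fun q : Measure E × (Fin n → ℝ) =>
      ∫⁻ e, Φ (q, e) ∂(Measure.pi (fun _ : Fin n => gaussianReal 0 1)) := hΦ.lintegral_prod_right'
  rw [e1, h1, lintegral_prod _ hΦ.aemeasurable, lintegral_prod _ h2.aemeasurable,
    lintegral_map h2.lintegral_prod_right' hN]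

omit [MeasurableSpace S] in
theorem setLIntegral_le_tau (B : Set E) (ω : S) (i : Fin n) :
    ∫⁻ v in B, (f i v : ℝ≥0∞) ∂(N ω) ≤ tau f N ω i := setLIntegral_le_lintegral _ _

/-- Integrating the conditional probability over an event of `(N, Z, ε)` gives this identity in `ℝ`;
it lifts to `[0, ∞]` because the product of ratios is at most one. -/
theorem IsModel.measure_inter_V (hM : IsModel P ν f N Z ε V) (hf : ∀ i, Measurable (f i))
    {H : Set (Measure E × (Fin n → ℝ) × (Fin n → ℝ))} (hH : MeasurableSet H)
    (hpos : ∀ p ∈ H, ∀ i, 0 < tau f Prod.fst p i) {B : Fin n → Set E}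
    (hB : ∀ i, MeasurableSet (B i)) :
    P ((fun ω => (N ω, Z ω, ε ω)) ⁻¹' H ∩ V ⁻¹' Set.univ.pi B) =
      ∫⁻ ω in (fun ω => (N ω, Z ω, ε ω)) ⁻¹' H,
        ∏ i, (∫⁻ v in B i, (f i v : ℝ≥0∞) ∂(N ω)) / tau f N ω i ∂P := by
  have hT := hM.measurable_triple
  set T := fun ω => (N ω, Z ω, ε ω) with hTdef
  have hle : MeasurableSpace.comap T inferInstance ≤ (inferInstance : MeasurableSpace S) :=
    hT.comap_le
  have hHm : MeasurableSet[MeasurableSpace.comap T inferInstance] (T ⁻¹' H) := ⟨H, hH, rfl⟩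
  have hVm : MeasurableSet {ω | ∀ i, V ω i ∈ B i} := by
    have : {ω | ∀ i, V ω i ∈ B i} = V ⁻¹' Set.univ.pi B := by ext; simp
    rw [this]; exact hM.measurable_V (MeasurableSet.univ_pi hB)
  have hVeq : V ⁻¹' Set.univ.pi B = {ω | ∀ i, V ω i ∈ B i} := by ext; simp
  let q : S → ℝ≥0∞ := fun ω => ∏ i, (∫⁻ v in B i, (f i v : ℝ≥0∞) ∂(N ω)) / tau f N ω i
  have hq1 : ∀ ω, q ω ≤ 1 := fun ω => Finset.prod_le_one' fun i _ =>
    ENNReal.div_le_of_le_mul (by simpa using setLIntegral_le_tau (N := N) (f := f) (B i) ω i)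
  have hqm : Measurable q := Finset.measurable_fun_prod _ fun i _ =>
    ((measurable_setLIntegral_coe (hf i) (hB i)).comp hM.poisson.measurable).div
      (measurable_tau hf hM.poisson.measurable i)
  have h1 : ∫ ω in T ⁻¹' H, (P⟦{ω' | ∀ i, V ω' i ∈ B i} |
      MeasurableSpace.comap T inferInstance⟧) ω ∂P =
      P.real ({ω | ∀ i, V ω i ∈ B i} ∩ T ⁻¹' H) := by
    rw [setIntegral_condExp hle ((integrable_const (1 : ℝ)).indicator hVm) hHm,
      integral_indicator hVm, setIntegral_const, smul_eq_mul, mul_one,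
      measureReal_restrict_apply hVm]
  have h2 : ∫ ω in T ⁻¹' H, (P⟦{ω' | ∀ i, V ω' i ∈ B i} |
      MeasurableSpace.comap T inferInstance⟧) ω ∂P = ∫ ω in T ⁻¹' H, (q ω).toReal ∂P := by
    refine setIntegral_congr_ae (hT hH) ?_
    filter_upwards [hM.cond_V B hB] with ω hω hωH
    rw [hω fun i => hpos _ hωH i]
    exact (ENNReal.toReal_prod _ _).symm
  rw [integral_toReal hqm.aemeasurable (ae_of_all _ fun ω => (hq1 ω).trans_lt ENNReal.one_lt_top)]
    at h2
  have hfin : ∫⁻ ω in T ⁻¹' H, q ω ∂P ≠ ∞ := by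
    refine ne_top_of_le_ne_top (b := ∫⁻ _, 1 ∂P) (by simp) ?_
    exact (setLIntegral_le_lintegral _ _).trans (lintegral_mono hq1)
  rw [hVeq, Set.inter_comm]
  exact (ENNReal.toReal_eq_toReal_iff' (measure_ne_top _ _) hfin).1 (h1.symm.trans h2)

/-- The central cancellation: the factor `τ_i` of the density of `W_i` removes the denominator of
the law of `V_i`. For each `w` this leaves `∏ e^{-w_i τ_i} N(f_i 1_{B_i})`, whose mean is
`palm_formula_weights`. -/
theorem IsModel.measure_joint_box [SigmaFinite ν] (hM : IsModel P ν f N Z ε V)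
    (hf : ∀ i, Measurable (f i))
    (hΛ : ∀ w : Fin n → ℝ, (∀ i, 0 ≤ w i) → laplaceExponent ν (bigOmega f w) < ∞)
    (m β : ℝ) {D : Set ((Fin n → ℝ) × (Fin n → ℝ))} (hD : MeasurableSet D) {B : Fin n → Set E}
    (hB : ∀ i, MeasurableSet (B i)) :
    P ({ω | ∀ i, 0 < tau f N ω i} ∩
        (fun ω => (latentW f N Z ω, returns m β f N Z ε ω)) ⁻¹' D ∩ V ⁻¹' Set.univ.pi B) =
      ∫⁻ w, (∫⁻ x, normalFactor m β x w * D.indicator 1 (w, x)) *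
        (expNegLaplace ν (bigOmega f w) * weightedMoment ν f w (Set.univ.pi B))
        ∂(orthantVolume n) := by
  classical
  have hN := hM.poisson.measurable
  have hτ : ∀ i, Measurable fun p : Measure E × (Fin n → ℝ) × (Fin n → ℝ) =>
    tau f Prod.fst p i := fun i => measurable_tau hf measurable_fst i
  let H₀ : Set (Measure E × (Fin n → ℝ) × (Fin n → ℝ)) := {p | ∀ i, 0 < tau f Prod.fst p i}
  let H₁ : Set (Measure E × (Fin n → ℝ) × (Fin n → ℝ)) :=
    (fun p => (latentW f Prod.fst (fun q => q.2.1) p,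
      returns m β f Prod.fst (fun q => q.2.1) (fun q => q.2.2) p)) ⁻¹' D
  have hH₀ : MeasurableSet H₀ := by
    have : H₀ = ⋂ i, {p | 0 < tau f Prod.fst p i} := by ext; simp [H₀]
    rw [this]
    exact MeasurableSet.iInter fun i => measurableSet_lt measurable_const (hτ i)
  have hH₁ : MeasurableSet H₁ :=
    ((measurable_latentW_triple hf).prodMk (measurable_returns_triple m β hf)) hD
  have hH := hH₀.inter hH₁
  let a : Measure E → Fin n → ℝ≥0∞ := fun μ i => ∫⁻ v in B i, (f i v : ℝ≥0∞) ∂μ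
  have ha : ∀ i, Measurable fun μ => a μ i := fun i => measurable_setLIntegral_coe (hf i) (hB i)
  let r : Measure E → ℝ≥0∞ := fun μ => ∏ i, a μ i / tau f id μ i
  have hr : Measurable r := Finset.measurable_fun_prod _ fun i _ =>
    (ha i).div (measurable_tau_id hf i)
  have e1 : {ω | ∀ i, 0 < tau f N ω i} ∩
      (fun ω => (latentW f N Z ω, returns m β f N Z ε ω)) ⁻¹' D =
      (fun ω => (N ω, Z ω, ε ω)) ⁻¹' (H₀ ∩ H₁) := rfl
  rw [e1, hM.measure_inter_V hf hH (fun p hp i => hp.1 i) hB,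
    ← lintegral_indicator (hM.measurable_triple hH)]
  have e2 : ∀ ω, ((fun ω => (N ω, Z ω, ε ω)) ⁻¹' (H₀ ∩ H₁)).indicator
      (fun ω => ∏ i, (∫⁻ v in B i, (f i v : ℝ≥0∞) ∂(N ω)) / tau f N ω i) ω =
      (H₀ ∩ H₁).indicator (fun p => r p.1) (N ω, Z ω, ε ω) := fun ω => rfl
  simp_rw [e2]
  rw [hM.lintegral_triple ((hr.fun_comp measurable_fst).indicator hH)]
  have e3 : ∀ᵐ ω ∂P, ∫⁻ z, ∫⁻ e, (H₀ ∩ H₁).indicator (fun p => r p.1) (N ω, z, e)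
      ∂(Measure.pi (fun _ : Fin n => gaussianReal 0 1))
      ∂(Measure.pi (fun _ : Fin n => gammaMeasure 1 1)) =
      ∫⁻ w, (∫⁻ x, normalFactor m β x w * D.indicator 1 (w, x)) *
        ∏ i, (negExp (ENNReal.ofReal (w i) * tau f N ω i) * a (N ω) i) ∂(orthantVolume n) := by
    filter_upwards [ae_tau_lt_top hM.poisson hf hΛ] with ω hω
    by_cases hpos : ∀ i, 0 < tau f N ω i
    · have ht : ∀ i, 0 < (tau f N ω i).toReal := fun i =>
        ENNReal.toReal_pos (hpos i).ne' (hω i).ne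
      have h1 : ∀ z e : Fin n → ℝ, (H₀ ∩ H₁).indicator (fun p => r p.1) (N ω, z, e) =
          r (N ω) * D.indicator 1 (fun i => z i / (tau f N ω i).toReal,
            fun i => m + (tau f N ω i).toReal / z i * β +
              √((tau f N ω i).toReal / z i) * e i) := by
        intro z e
        have hmem : (N ω, z, e) ∈ H₀ ∩ H₁ ↔ (fun i => z i / (tau f N ω i).toReal,
            fun i => m + (tau f N ω i).toReal / z i * β +
              √((tau f N ω i).toReal / z i) * e i) ∈ D :=
          ⟨fun h => h.2, fun h => ⟨hpos, h⟩⟩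
        by_cases h : (N ω, z, e) ∈ H₀ ∩ H₁
        · rw [Set.indicator_of_mem h, Set.indicator_of_mem (hmem.1 h), Pi.one_apply, mul_one]
        · rw [Set.indicator_of_notMem h, Set.indicator_of_notMem (fun h' => h (hmem.2 h')),
            mul_zero]
      have hrfin : r (N ω) ≠ ∞ := ENNReal.prod_ne_top fun i _ =>
        ENNReal.div_ne_top ((setLIntegral_le_tau (N := N) (B i) ω i).trans_lt (hω i)).ne
          (hpos i).ne'
      simp_rw [h1, lintegral_const_mul' _ _ hrfin]
      rw [lintegral_gamma_gaussian m β ht (measurable_one.indicator hD),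
        ← lintegral_const_mul' _ _ hrfin]
      refine lintegral_congr_ae ?_
      filter_upwards [ae_orthantVolume_pos n] with w hw
      rw [← mul_assoc, mul_comm]
      congr 1
      rw [← Finset.prod_mul_distrib]
      refine Finset.prod_congr rfl fun i _ => ?_
      have hτi : tau f N ω i = ENNReal.ofReal (tau f N ω i).toReal :=
        (ENNReal.ofReal_toReal (hω i).ne).symm
      have h2 : ENNReal.ofReal (Real.exp (-(w i * (tau f N ω i).toReal)) *
          (tau f N ω i).toReal) =
          negExp (ENNReal.ofReal (w i) * tau f N ω i) * tau f N ω i := by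
        rw [ENNReal.ofReal_mul (Real.exp_nonneg _), ENNReal.ofReal_toReal (hω i).ne,
          ← negExp_ofReal (mul_nonneg (hw i).le (ht i).le), ENNReal.ofReal_mul (hw i).le,
          ENNReal.ofReal_toReal (hω i).ne]
      rw [h2, mul_comm, mul_assoc]
      congr 1
      exact ENNReal.mul_div_cancel (hpos i).ne' (hω i).ne
    -- If some `τ_i` vanishes, the left side is cut off by `H₀`, and the right side is zero because
    -- `N(f_i 1_{B_i}) ≤ τ_i`. Hence the restriction disappears from the right side before averaging
    -- over `N`.
    · have h1 : ∀ z e : Fin n → ℝ, (H₀ ∩ H₁).indicator (fun p => r p.1) (N ω, z, e) = 0 :=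
        fun z e => Set.indicator_of_notMem (fun h => hpos h.1) _
      push Not at hpos
      obtain ⟨i, hi⟩ := hpos
      have hai : a (N ω) i = 0 :=
        le_antisymm ((setLIntegral_le_tau (N := N) (B i) ω i).trans hi) zero_le
      have h2 : ∀ w : Fin n → ℝ,
          ∏ i, (negExp (ENNReal.ofReal (w i) * tau f N ω i) * a (N ω) i) = 0 := fun w =>
        Finset.prod_eq_zero (Finset.mem_univ i) (by rw [hai, mul_zero])
      simp_rw [h1, h2]
      simp
  rw [lintegral_congr_ae e3]
  have hinner : Measurable fun w : Fin n → ℝ =>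
      ∫⁻ x, normalFactor m β x w * D.indicator 1 (w, x) := by
    refine Measurable.lintegral_prod_right'
      (f := fun z : (Fin n → ℝ) × (Fin n → ℝ) =>
        normalFactor m β z.2 z.1 * D.indicator 1 (z.1, z.2)) ?_
    exact (Measurable.comp (f := fun z : (Fin n → ℝ) × (Fin n → ℝ) => (z.2, z.1))
      (measurable_normalFactor m β) measurable_swap).mul (measurable_one.indicator hD)
  have hprod : Measurable fun z : S × (Fin n → ℝ) =>
      ∏ i, (negExp (ENNReal.ofReal (z.2 i) * tau f N z.1 i) * a (N z.1) i) := by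
    have h1 := fun i => (measurable_tau hf hN i).comp
      (measurable_fst : Measurable (Prod.fst : S × (Fin n → ℝ) → S))
    have h2 := fun i => ((ha i).comp hN).comp
      (measurable_fst : Measurable (Prod.fst : S × (Fin n → ℝ) → S))
    simp only [Function.comp_def] at h1 h2
    fun_prop
  rw [lintegral_lintegral_swap ((hinner.comp measurable_snd).mul hprod).aemeasurable]
  refine lintegral_congr_ae ?_
  filter_upwards [ae_orthantVolume_pos n] with w hw
  rw [lintegral_const_mul _ (hprod.fun_comp (measurable_prodMk_right (y := w)))]
  rw [← palm_formula_weights hM.poisson hf (fun i => (hw i).le) (hΛ w fun i => (hw i).le) hB]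

theorem IsModel.map_joint_law [SigmaFinite ν] (hM : IsModel P ν f N Z ε V)
    (hf : ∀ i, Measurable (f i))
    (hΛ : ∀ w : Fin n → ℝ, (∀ i, 0 ≤ w i) → laplaceExponent ν (bigOmega f w) < ∞)
    (m β : ℝ) (K : Kernel (Fin n → ℝ) (Fin n → E)) [IsSFiniteKernel K]
    (hK : ∀ w, K w = weightedMoment ν f w) :
    (P.restrict {ω | ∀ i, 0 < tau f N ω i}).map
        (fun ω => ((latentW f N Z ω, returns m β f N Z ε ω), V ω)) =
      (((orthantVolume n).prod volume).withDensity
        (fun z => normalFactor m β z.2 z.1 * expNegLaplace ν (bigOmega f z.1))) ⊗ₘ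
        (K.comap Prod.fst measurable_fst) := by
  have hW := hM.measurable_latentW hf
  have hX := hM.measurable_returns hf m β
  have hWX := hW.prodMk hX
  have hV := hM.measurable_V
  have hnf : Measurable fun z : (Fin n → ℝ) × (Fin n → ℝ) => normalFactor m β z.2 z.1 :=
    Measurable.comp (f := fun z : (Fin n → ℝ) × (Fin n → ℝ) => (z.2, z.1))
      (measurable_normalFactor m β) measurable_swap
  have he : Measurable fun z : (Fin n → ℝ) × (Fin n → ℝ) => expNegLaplace ν (bigOmega f z.1) :=
    Measurable.comp (f := fun z : (Fin n → ℝ) × (Fin n → ℝ) => z.1)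
      (measurable_expNegLaplace hf) measurable_fst
  set Q := P.restrict {ω | ∀ i, 0 < tau f N ω i} with hQ
  set base := ((orthantVolume n).prod volume).withDensity
        (fun z : (Fin n → ℝ) × (Fin n → ℝ) =>
          normalFactor m β z.2 z.1 * expNegLaplace ν (bigOmega f z.1)) with hbase
  have hbox : ∀ D : Set ((Fin n → ℝ) × (Fin n → ℝ)), MeasurableSet D → ∀ B : Fin n → Set E,
      (∀ i, MeasurableSet (B i)) →
      Q.map (fun ω => ((latentW f N Z ω, returns m β f N Z ε ω), V ω)) (D ×ˢ Set.univ.pi B) =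
        (base ⊗ₘ (K.comap Prod.fst measurable_fst)) (D ×ˢ Set.univ.pi B) := by
    intro D hD B hB
    have hBm := MeasurableSet.univ_pi hB
    have hKm := K.measurable_coe hBm
    have hKf : Measurable fun z : (Fin n → ℝ) × (Fin n → ℝ) => K z.1 (Set.univ.pi B) :=
      hKm.comp measurable_fst
    have hset : (fun ω => ((latentW f N Z ω, returns m β f N Z ε ω), V ω)) ⁻¹'
          (D ×ˢ Set.univ.pi B) ∩ {ω | ∀ i, 0 < tau f N ω i} =
        {ω | ∀ i, 0 < tau f N ω i} ∩
          (fun ω => (latentW f N Z ω, returns m β f N Z ε ω)) ⁻¹' D ∩ V ⁻¹' Set.univ.pi B := by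
      ext ω
      simp only [Set.mem_inter_iff, Set.mem_preimage, Set.mem_prod]
      tauto
    rw [Measure.map_apply (hWX.prodMk hV) (hD.prod hBm), hQ,
      Measure.restrict_apply ((hWX.prodMk hV) (hD.prod hBm)), hset,
      hM.measure_joint_box hf hΛ m β hD hB, Measure.compProd_apply_prod hD hBm,
      ← lintegral_indicator hD]
    simp only [Kernel.comap_apply]
    rw [hbase, lintegral_withDensity_eq_lintegral_mul _ (hnf.fun_mul he) (hKf.indicator hD),
      lintegral_prod _ ((hnf.fun_mul he).mul (hKf.indicator hD)).aemeasurable]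
    refine lintegral_congr fun w => ?_
    have h1 : Measurable fun x : Fin n → ℝ => normalFactor m β x w * D.indicator 1 (w, x) :=
      (Measurable.comp (f := fun x : Fin n → ℝ => (x, w)) (measurable_normalFactor m β)
        measurable_prodMk_right).mul
        (Measurable.comp (f := fun x : Fin n → ℝ => (w, x)) (measurable_one.indicator hD)
          measurable_prodMk_left)
    rw [← lintegral_mul_const _ h1, ← hK]
    refine lintegral_congr fun x => ?_
    rw [Pi.mul_apply]
    by_cases h : (w, x) ∈ D
    · simp only [Set.indicator_of_mem h, Pi.one_apply]; ring
    · simp [Set.indicator_of_notMem h]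
  refine Measure.ext_prod fun {D} {A} hD hA => ?_
  -- For fixed `D` each side becomes a measure in `A`, so that agreement on the π-system of boxes,
  -- together with equal total mass, suffices.
  have hrestr : ∀ ρ : Measure (((Fin n → ℝ) × (Fin n → ℝ)) × (Fin n → E)),
      ∀ A : Set (Fin n → E), MeasurableSet A →
      (ρ.restrict (D ×ˢ Set.univ)).map Prod.snd A = ρ (D ×ˢ A) := by
    intro ρ A hA
    rw [Measure.map_apply measurable_snd hA, Measure.restrict_apply (measurable_snd hA)]
    congr 1
    ext z
    simp [and_comm]
  rw [← hrestr _ A hA, ← hrestr _ A hA]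
  congr 1
  refine ext_of_generate_finite _ generateFrom_pi.symm isPiSystem_pi ?_ ?_
  · rintro _ ⟨B, hB, rfl⟩
    have hB' : ∀ i, MeasurableSet (B i) := fun i => hB i trivial
    rw [hrestr _ _ (MeasurableSet.univ_pi hB'), hrestr _ _ (MeasurableSet.univ_pi hB')]
    exact hbox D hD B hB'
  · rw [hrestr _ _ MeasurableSet.univ, hrestr _ _ MeasurableSet.univ,
      ← Set.pi_univ (Set.univ : Set (Fin n))]
    exact hbox D hD _ fun _ => MeasurableSet.univ

theorem IsModel.lintegral_joint [SigmaFinite ν] (hM : IsModel P ν f N Z ε V)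
    (hf : ∀ i, Measurable (f i))
    (hΛ : ∀ w : Fin n → ℝ, (∀ i, 0 ≤ w i) → laplaceExponent ν (bigOmega f w) < ∞)
    (m β : ℝ) (K : Kernel (Fin n → ℝ) (Fin n → E)) [IsSFiniteKernel K]
    (hK : ∀ w, K w = weightedMoment ν f w)
    {F : ((Fin n → ℝ) × (Fin n → ℝ)) × (Fin n → E) → ℝ≥0∞} (hF : Measurable F) :
    ∫⁻ ω in {ω | ∀ i, 0 < tau f N ω i},
        F ((latentW f N Z ω, returns m β f N Z ε ω), V ω) ∂P =
      ∫⁻ w, ∫⁻ x, normalFactor m β x w * expNegLaplace ν (bigOmega f w) *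
        ∫⁻ v, F ((w, x), v) ∂(K w) ∂volume ∂(orthantVolume n) := by
  have hWX := (hM.measurable_latentW hf).prodMk (hM.measurable_returns hf m β)
  have hdens : Measurable fun z : (Fin n → ℝ) × (Fin n → ℝ) =>
      normalFactor m β z.2 z.1 * expNegLaplace ν (bigOmega f z.1) :=
    (Measurable.comp (f := fun z : (Fin n → ℝ) × (Fin n → ℝ) => (z.2, z.1))
      (measurable_normalFactor m β) measurable_swap).mul
      (Measurable.comp (f := fun z : (Fin n → ℝ) × (Fin n → ℝ) => z.1)
        (measurable_expNegLaplace hf) measurable_fst)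
  have hFK : Measurable fun z : (Fin n → ℝ) × (Fin n → ℝ) =>
      ∫⁻ v, F (z, v) ∂(K.comap Prod.fst measurable_fst z) := hF.lintegral_kernel_prod_right'
  rw [← lintegral_map hF (hWX.prodMk hM.measurable_V), hM.map_joint_law hf hΛ m β K hK,
    Measure.lintegral_compProd hF, lintegral_withDensity_eq_lintegral_mul _ hdens hFK,
    lintegral_prod _ (hdens.mul hFK).aemeasurable]
  rfl

end JointLaw

/-! ### Normal densities as generalized inverse Gaussian densities in `w`. -/

section GIG

theorem sq_div_four_le_cosh (t : ℝ) : t ^ 2 / 4 ≤ Real.cosh t := by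
  have h : ∀ u : ℝ, 0 ≤ u → u ^ 2 / 4 ≤ Real.cosh u := fun u hu => by
    have h1 := Real.quadratic_le_exp_of_nonneg hu
    have h2 := Real.add_one_le_exp (-u)
    rw [Real.cosh_eq]
    linarith
  simpa using h |t| (abs_nonneg t)

theorem integrableOn_besselK (l : ℝ) {z : ℝ} (hz : 0 < z) :
    IntegrableOn (fun t => Real.exp (-(z * Real.cosh t)) * Real.cosh (l * t)) (Set.Ioi 0) := by
  refine Integrable.integrableOn ?_
  have hb : Integrable fun t : ℝ => Real.exp (2 * l ^ 2 / z) * Real.exp (-(z / 8) * t ^ 2) :=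
    (integrable_exp_neg_mul_sq (by positivity)).const_mul _
  refine hb.mono' (by fun_prop) (ae_of_all _ fun t => ?_)
  rw [Real.norm_of_nonneg (mul_nonneg (Real.exp_nonneg _) (Real.cosh_pos _).le)]
  have h1 : Real.cosh (l * t) ≤ Real.exp |l * t| := by
    rw [← Real.cosh_abs, Real.cosh_eq]
    have : Real.exp (-|l * t|) ≤ Real.exp |l * t| :=
      Real.exp_le_exp.2 (by linarith [abs_nonneg (l * t)])
    linarith
  refine (mul_le_mul_of_nonneg_left h1 (Real.exp_nonneg _)).trans ?_
  rw [← Real.exp_add, ← Real.exp_add]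
  refine Real.exp_le_exp.2 ?_
  have h2 := mul_le_mul_of_nonneg_left (sq_div_four_le_cosh t) hz.le
  -- Completing the square: half of the decay `z t² / 4` supplied by `cosh` absorbs the linear
  -- growth, and the other half remains as a Gaussian bound.
  have h3 : |l * t| ≤ z * t ^ 2 / 8 + 2 * l ^ 2 / z := by
    have h4 : z * t ^ 2 / 8 + 2 * l ^ 2 / z - |l * t| = z / 8 * (|t| - 4 * |l| / z) ^ 2 := by
      rw [abs_mul]
      field_simp
      nlinarith [sq_abs t, sq_abs l]
    nlinarith [mul_nonneg (div_nonneg hz.le (by norm_num : (0 : ℝ) ≤ 8))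
      (sq_nonneg (|t| - 4 * |l| / z))]
  linarith

/-- The integrand is positive everywhere. Integrability is essential, since a divergent integral
would take the default value zero. -/
theorem besselK_pos (l : ℝ) {z : ℝ} (hz : 0 < z) : 0 < besselK l z := by
  rw [besselK, setIntegral_pos_iff_support_of_nonneg_ae]
  · have : Function.support (fun t => Real.exp (-(z * Real.cosh t)) * Real.cosh (l * t)) =
        Set.univ := Set.eq_univ_of_forall fun t =>
      (mul_pos (Real.exp_pos _) (Real.cosh_pos _)).ne'
    rw [this, Set.univ_inter]
    simp
  · exact ae_of_all _ fun t => mul_nonneg (Real.exp_nonneg _) (Real.cosh_pos _).le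
  · exact integrableOn_besselK l hz

/-- Gathers the gamma branch `β = 0` and the Bessel branch in one formula with an unspecified
constant. The power is `3/2 - 1 = 1/2`. -/
theorem exists_gigPDF_eq (β : ℝ) {γ : ℝ} (hγ : 0 < γ) :
    ∃ C : ℝ, 0 < C ∧ ∀ w : ℝ, 0 < w → gigPDF (3 / 2) |β| γ w =
      C * (√w * Real.exp (-(1 / 2) * (β ^ 2 * w⁻¹ + γ ^ 2 * w))) := by
  have hpow : ∀ w : ℝ, w ^ ((3 : ℝ) / 2 - 1) = √w := fun w => by
    rw [Real.sqrt_eq_rpow]; norm_num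
  by_cases hβ : β = 0
  · refine ⟨(γ ^ 2 / 2) ^ ((3 : ℝ) / 2) / Real.Gamma (3 / 2), ?_, fun w hw => ?_⟩
    · exact div_pos (Real.rpow_pos_of_pos (by positivity) _) (Real.Gamma_pos_of_pos (by norm_num))
    · rw [gigPDF, if_neg hw.not_ge, if_pos (by simp [hβ]), gammaPDFReal, if_pos hw.le, hpow,
        mul_assoc, hβ]
      congr 3
      ring
  · have hβ' : 0 < |β| := abs_pos.2 hβ
    refine ⟨(γ / |β|) ^ ((3 : ℝ) / 2) / (2 * besselK (3 / 2) (|β| * γ)), ?_, fun w hw => ?_⟩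
    · exact div_pos (Real.rpow_pos_of_pos (by positivity) _)
        (mul_pos two_pos (besselK_pos _ (by positivity)))
    · rw [gigPDF, if_neg hw.not_ge, if_neg hβ'.ne', if_neg hγ.ne', hpow, sq_abs, mul_assoc]

/-- In the expansion of `w (x - m - β / w)²` the cross term does not involve `w`, so it goes into
the constant, and the normal prefactor supplies `√w`. The condition `x ≠ m` keeps the last GIG
parameter positive even for `s = 0`. -/
theorem exists_gaussianPDF_mul_exp_eq (m β : ℝ) {x : ℝ} (hx : x ≠ m) {s : ℝ} (hs : 0 ≤ s) :
    ∃ c : ℝ, 0 < c ∧ ∀ w : ℝ, 0 < w →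
      gaussianPDF (m + β * w⁻¹) (Real.toNNReal w⁻¹) x * ENNReal.ofReal (Real.exp (-(w * s))) =
        ENNReal.ofReal c *
          ENNReal.ofReal (gigPDF (3 / 2) |β| (√((x - m) ^ 2 + 2 * s)) w) := by
  have hpos : 0 < (x - m) ^ 2 + 2 * s := by
    have : 0 < (x - m) ^ 2 := by have := sub_ne_zero.2 hx; positivity
    linarith
  obtain ⟨C, hC, hgig⟩ := exists_gigPDF_eq β (Real.sqrt_pos.2 hpos)
  refine ⟨Real.exp ((x - m) * β) / √(2 * Real.pi) / C, by positivity, fun w hw => ?_⟩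
  rw [hgig w hw, gaussianPDF, gaussianPDFReal, ← ENNReal.ofReal_mul (by positivity),
    ← ENNReal.ofReal_mul (by positivity), Real.coe_toNNReal _ (inv_nonneg.2 hw.le),
    Real.sq_sqrt hpos.le]
  congr 1
  have h1 : (√(2 * Real.pi * w⁻¹))⁻¹ = √w / √(2 * Real.pi) := by
    rw [Real.sqrt_mul (by positivity), Real.sqrt_inv, mul_inv, inv_inv]
    ring
  rw [h1]
  have h2 : Real.exp (-(x - (m + β * w⁻¹)) ^ 2 / (2 * w⁻¹)) * Real.exp (-(w * s)) =
      Real.exp ((x - m) * β) *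
        Real.exp (-(1 / 2) * (β ^ 2 * w⁻¹ + ((x - m) ^ 2 + 2 * s) * w)) := by
    rw [← Real.exp_add, ← Real.exp_add]
    congr 1
    field_simp
    ring
  rw [mul_assoc, h2]
  field_simp

end GIG

/-! ### Distinct values, and intensities without atoms. -/

section Distinct

variable {n : ℕ} {E : Type*}

theorem sumDistinct_nonneg (g : E → ℝ≥0) (v : Fin n → E) : 0 ≤ sumDistinct g v :=
  Finset.sum_nonneg fun _ _ => NNReal.coe_nonneg _

theorem measurable_sumDistinct [MeasurableSpace E] [MeasurableEq E] {g : E → ℝ≥0}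
    (hg : Measurable g) : Measurable (fun v : Fin n → E => sumDistinct g v) := by
  classical
  -- Weighting each index by the inverse multiplicity of its value replaces the sum over a varying
  -- set of values by a sum over all indices, which is visibly measurable.
  have key : (fun v : Fin n → E => sumDistinct g v) =
      fun v => ∑ i, (g (v i) : ℝ) / ∑ j, {u : Fin n → E | u j = u i}.indicator 1 v := by
    funext v
    have h1 := Finset.sum_comp (s := Finset.univ)
      (fun a => (g a : ℝ) / ((Finset.univ.filter fun j => v j = a).card : ℝ)) v
    have h2 : ∀ i, ∑ j, {u : Fin n → E | u j = u i}.indicator (1 : (Fin n → E) → ℝ) v =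
        ((Finset.univ.filter fun j => v j = v i).card : ℝ) := fun i => by
      simp [Set.indicator_apply, Finset.sum_boole]
    simp_rw [h2]
    rw [h1, sumDistinct]
    refine Finset.sum_congr (by congr) fun a ha => ?_
    obtain ⟨i, -, hi⟩ := Finset.mem_image.1 ha
    have : ((Finset.univ.filter fun j => v j = a).card : ℝ) ≠ 0 := by
      exact_mod_cast (Finset.card_pos.2 ⟨i, by simp [hi]⟩).ne'
    rw [nsmul_eq_mul]
    field_simp
  rw [key]
  refine Finset.measurable_fun_sum _ fun i _ => Measurable.div
    (hg.coe_nnreal_real.comp (measurable_pi_apply i)) (Finset.measurable_fun_sum _ fun j _ => ?_)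
  exact measurable_one.indicator
    (measurableSet_eq_fun (measurable_pi_apply j) (measurable_pi_apply i))

theorem sumDistinct_spread (g : E → ℝ≥0) (p : Finpartition (Finset.univ : Finset (Fin n)))
    {y : p.parts → E} (hy : Function.Injective y) :
    sumDistinct g (spread p y) = ∑ c, (g (y c) : ℝ) := by
  classical
  have himg : (Finset.univ.image (spread p y)) = Finset.univ.image y := by
    ext a
    simp only [Finset.mem_image, Finset.mem_univ, true_and]
    constructor
    · rintro ⟨i, hi⟩
      exact ⟨_, hi⟩
    · rintro ⟨c, hc⟩
      obtain ⟨i, hi⟩ := p.nonempty_of_mem_parts c.2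
      refine ⟨i, ?_⟩
      rw [← hc, spread]
      congr 1
      exact Subtype.ext (p.part_eq_of_mem c.2 hi)
  rw [sumDistinct]
  have : ∑ a ∈ Finset.univ.image (spread p y), (g a : ℝ) = ∑ c, (g (y c) : ℝ) := by
    rw [himg, Finset.sum_image fun _ _ _ _ h => hy h]
  convert this

theorem prod_exp_neg_bigOmega (f : Fin n → E → ℝ≥0) (w : Fin n → ℝ)
    (p : Finpartition (Finset.univ : Finset (Fin n))) {y : p.parts → E}
    (hy : Function.Injective y) :
    ∏ c, ENNReal.ofReal (Real.exp (-bigOmega f w (y c))) =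
      ∏ i, ENNReal.ofReal (Real.exp (-(w i * sumDistinct (f i) (spread p y)))) := by
  rw [← ENNReal.ofReal_prod_of_nonneg fun _ _ => Real.exp_nonneg _,
    ← ENNReal.ofReal_prod_of_nonneg fun _ _ => Real.exp_nonneg _, ← Real.exp_sum, ← Real.exp_sum]
  congr 2
  simp_rw [sumDistinct_spread _ p hy, bigOmega, Finset.sum_neg_distrib, Finset.mul_sum]
  rw [Finset.sum_comm]

/-- The measure `(∏ i, f_i(v_i)) 𝓜(dv | ν)`, without tilting. -/
def untiltedMoment [MeasurableSpace E] (ν : Measure E) (f : Fin n → E → ℝ≥0) :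
    Measure (Fin n → E) :=
  (momentMeasure n ν).withDensity (fun v => ∏ i, (f i (v i) : ℝ≥0∞))

instance [MeasurableSpace E] (ν : Measure E) [SigmaFinite ν] (f : Fin n → E → ℝ≥0) :
    SFinite (untiltedMoment ν f) := by
  unfold untiltedMoment momentMeasure
  rw [← Measure.sum_fintype]
  infer_instance

/-- Almost surely distinct cells carry distinct points, so the tilt over the cells is a function of
`v` alone, the same for every partition. The reference measure `untiltedMoment` no longer involves
`w`, as conditioning on `V` requires. -/
theorem weightedMoment_of_noAtoms [MeasurableSpace E] [MeasurableEq E] {ν : Measure E}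
    [SigmaFinite ν] (hν : ∀ v, ν {v} = 0) {f : Fin n → E → ℝ≥0} (hf : ∀ i, Measurable (f i))
    (w : Fin n → ℝ) :
    weightedMoment ν f w = (untiltedMoment ν f).withDensity
      (fun v => ∏ i, ENNReal.ofReal (Real.exp (-(w i * sumDistinct (f i) v)))) := by
  have hfm := measurable_prod_coe hf
  have hs := fun i => measurable_sumDistinct (n := n) (hf i)
  have hd : Measurable fun v : Fin n → E =>
      ∏ i, ENNReal.ofReal (Real.exp (-(w i * sumDistinct (f i) v))) := by fun_prop
  refine Measure.ext_of_lintegral _ fun F hF => ?_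
  rw [weightedMoment_eq_sum ν hf, untiltedMoment,
    lintegral_withDensity_eq_lintegral_mul _ hd hF,
    lintegral_withDensity_eq_lintegral_mul _ hfm (hd.mul hF), momentMeasure,
    lintegral_finsetSum_measure, lintegral_finsetSum_measure]
  refine Finset.sum_congr rfl fun p _ => ?_
  change _ = ∫⁻ v, _ ∂(Measure.map (spread p) _)
  have hc : Measurable (cellDensity f p w) :=
    Measurable.comp (f := fun y : p.parts → E => (w, y)) (measurable_cellDensity hf p)
      measurable_prodMk_left
  rw [lintegral_map hF (measurable_spread p),
    lintegral_map (hfm.mul (hd.mul hF)) (measurable_spread p),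
    lintegral_withDensity_eq_lintegral_mul _ hc (hF.fun_comp (measurable_spread p))]
  refine lintegral_congr_ae ?_
  filter_upwards [pi_ae_injective (ι := p.parts) ν hν] with y hy
  simp only [Pi.mul_apply, cellDensity]
  rw [prod_exp_neg_bigOmega f w p hy]
  ring

end Distinct

theorem weightedMoment_eq_weightedMomentByCells {n : ℕ} {E : Type*} [MeasurableSpace E]
    (ν : Measure E) (f : Fin n → E → ℝ≥0) (w : Fin n → ℝ) :
    weightedMoment ν f w = weightedMomentByCells ν f w := by
  classical
  rw [weightedMoment, weightedMomentByCells]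
  congr 1
  funext v
  have h := Finset.prod_fiberwise_of_maps_to (s := Finset.univ) (t := Finset.univ.image v) (g := v)
    (fun i _ => Finset.mem_image_of_mem v (Finset.mem_univ i)) fun i => (f i (v i) : ℝ≥0∞)
  rw [← h]
  refine Finset.prod_congr (by congr) fun a _ => ?_
  refine Finset.prod_congr (by congr) fun i hi => ?_
  rw [(Finset.mem_filter.1 hi).2]

/-- Normalization forgets a constant factor; this discards the constants of the GIG densities. -/
theorem IsNormalization.of_smul {α : Type*} [MeasurableSpace α] {π ρ σ : Measure α} {c : ℝ≥0∞}
    (hc0 : c ≠ 0) (hc : c ≠ ∞) (hρ : ρ = c • σ) (h : IsNormalization π ρ) :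
    IsNormalization π σ := by
  subst hρ
  obtain ⟨h1, h2, h3⟩ := h
  rw [Measure.smul_apply, smul_eq_mul] at h1 h2 h3
  have hσ0 : σ Set.univ ≠ 0 := fun h => by rw [h, mul_zero] at h1; exact lt_irrefl _ h1
  have hσ : σ Set.univ ≠ ∞ := fun h => by
    rw [h, ENNReal.mul_top hc0] at h2; exact lt_irrefl _ h2
  refine ⟨pos_iff_ne_zero.2 hσ0, lt_top_iff_ne_top.2 hσ, ?_⟩
  rw [h3, smul_smul, ENNReal.mul_inv (Or.inl hc0) (Or.inl hc), mul_comm c⁻¹, mul_assoc,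
    ENNReal.inv_mul_cancel hc0 hc, mul_one]

/-! ### The posterior laws. -/

section Posterior

variable {n : ℕ} {S E : Type*} [MeasurableSpace S] [MeasurableSpace E]
  {P : Measure S} [IsProbabilityMeasure P] {ν : Measure E} [SigmaFinite ν] {f : Fin n → E → ℝ≥0}
  {N : S → Measure E} {Z ε : S → Fin n → ℝ} {V : S → Fin n → E}

theorem measurableSet_forall_ne (m : ℝ) : MeasurableSet {x : Fin n → ℝ | ∀ i, x i ≠ m} := by
  have : {x : Fin n → ℝ | ∀ i, x i ≠ m} = Set.univ.pi fun _ => {m}ᶜ := by ext; simp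
  rw [this]
  exact MeasurableSet.univ_pi fun _ => (measurableSet_singleton m).compl

-- With `τ_i = 0` both the drift and the noise term vanish, leaving `X_i = m`.
omit [MeasurableSpace S] in
theorem tau_pos_of_returns_ne {m β : ℝ} {ω : S} (h : ∀ i, returns m β f N Z ε ω i ≠ m) (i : Fin n) :
    0 < tau f N ω i := by
  by_contra h0
  refine h i ?_
  have : tau f N ω i = 0 := le_antisymm (not_lt.1 h0) zero_le
  simp [returns, this]

theorem measurable_normalFactor_swap (m β : ℝ) :
    Measurable fun z : (Fin n → ℝ) × (Fin n → ℝ) => normalFactor m β z.2 z.1 :=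
  Measurable.comp (f := fun z : (Fin n → ℝ) × (Fin n → ℝ) => (z.2, z.1))
    (measurable_normalFactor m β) measurable_swap

theorem measurable_joint_density (hf : ∀ i, Measurable (f i)) (m β : ℝ) :
    Measurable fun z : (Fin n → ℝ) × (Fin n → ℝ) =>
      normalFactor m β z.2 z.1 * expNegLaplace ν (bigOmega f z.1) :=
  (measurable_normalFactor_swap m β).mul
    (Measurable.comp (f := fun z : (Fin n → ℝ) × (Fin n → ℝ) => z.1)
      (measurable_expNegLaplace hf) measurable_fst)

/-- For sets with all `x_i ≠ m` the restriction to positive `τ_i` is automatic, so the joint density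
describes the unrestricted law. -/
theorem IsModel.measure_joint (hM : IsModel P ν f N Z ε V) (hf : ∀ i, Measurable (f i))
    (hΛ : ∀ w : Fin n → ℝ, (∀ i, 0 ≤ w i) → laplaceExponent ν (bigOmega f w) < ∞)
    (m β : ℝ) (K : Kernel (Fin n → ℝ) (Fin n → E)) [IsSFiniteKernel K]
    (hK : ∀ w, K w = weightedMoment ν f w)
    {T : Set (((Fin n → ℝ) × (Fin n → ℝ)) × (Fin n → E))} (hT : MeasurableSet T)
    (hTA : ∀ z ∈ T, ∀ i, z.1.2 i ≠ m) :
    P ((fun ω => ((latentW f N Z ω, returns m β f N Z ε ω), V ω)) ⁻¹' T) =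
      ∫⁻ w, ∫⁻ x, normalFactor m β x w * expNegLaplace ν (bigOmega f w) *
        K w {v | ((w, x), v) ∈ T} ∂volume ∂(orthantVolume n) := by
  have hm := ((hM.measurable_latentW hf).prodMk (hM.measurable_returns hf m β)).prodMk
    hM.measurable_V
  have h := hM.lintegral_joint hf hΛ m β K hK (measurable_one.indicator hT)
  have hsub : (fun ω => ((latentW f N Z ω, returns m β f N Z ε ω), V ω)) ⁻¹' T ⊆
      {ω | ∀ i, 0 < tau f N ω i} := fun ω hω i => tau_pos_of_returns_ne (hTA _ hω) i
  have e1 : ∫⁻ ω in {ω | ∀ i, 0 < tau f N ω i},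
      T.indicator 1 ((latentW f N Z ω, returns m β f N Z ε ω), V ω) ∂P =
      P ((fun ω => ((latentW f N Z ω, returns m β f N Z ε ω), V ω)) ⁻¹' T) := by
    have : ∀ ω, T.indicator (1 : ((Fin n → ℝ) × (Fin n → ℝ)) × (Fin n → E) → ℝ≥0∞)
        ((latentW f N Z ω, returns m β f N Z ε ω), V ω) =
        ((fun ω => ((latentW f N Z ω, returns m β f N Z ε ω), V ω)) ⁻¹' T).indicator 1 ω :=
      fun _ => rfl
    simp_rw [this]
    rw [lintegral_indicator_one (hm hT), Measure.restrict_apply (hm hT),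
      Set.inter_eq_left.2 hsub]
  rw [← e1, h]
  refine lintegral_congr fun w => lintegral_congr fun x => ?_
  congr 1
  have hTs : MeasurableSet {v | ((w, x), v) ∈ T} := measurable_prodMk_left hT
  rw [← lintegral_indicator_one hTs]
  rfl

/-- Where all `τ_i` are positive, `X` has a density, and the hyperplane `x_i = m` is Lebesgue null.
-/
theorem IsModel.ae_returns_ne (hM : IsModel P ν f N Z ε V) (hf : ∀ i, Measurable (f i))
    (hΛ : ∀ w : Fin n → ℝ, (∀ i, 0 ≤ w i) → laplaceExponent ν (bigOmega f w) < ∞)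
    (m β : ℝ) (hpos : ∀ᵐ ω ∂P, ∀ i, 0 < tau f N ω i) :
    ∀ᵐ x ∂(P.map (returns m β f N Z ε)), ∀ i, x i ≠ m := by
  obtain ⟨K, hKs, hK⟩ := exists_weightedMoment_kernel ν hf
  have hX := hM.measurable_returns hf m β
  rw [ae_map_iff hX.aemeasurable (measurableSet_forall_ne m), ae_all_iff]
  intro i
  have hs : MeasurableSet {x : Fin n → ℝ | x i = m} :=
    measurableSet_eq_fun (measurable_pi_apply i) measurable_const
  have hnull : (volume : Measure (Fin n → ℝ)) {x | x i = m} = 0 := by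
    rw [volume_pi]; exact Measure.pi_hyperplane (fun _ => (volume : Measure ℝ)) i m
  have h := hM.lintegral_joint hf hΛ m β K hK
    (F := fun z => {x : Fin n → ℝ | x i = m}.indicator 1 z.1.2)
    ((measurable_one.indicator hs).comp (measurable_snd.comp measurable_fst))
  have h0 : ∀ w : Fin n → ℝ, ∫⁻ x, normalFactor m β x w * expNegLaplace ν (bigOmega f w) *
      ∫⁻ _, {x : Fin n → ℝ | x i = m}.indicator 1 x ∂(K w) ∂volume = 0 := fun w => by
    rw [lintegral_congr_ae (g := fun _ => 0), lintegral_zero]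
    have : ∀ᵐ x : Fin n → ℝ, x ∉ {x | x i = m} := measure_eq_zero_iff_ae_notMem.1 hnull
    filter_upwards [this] with x hx
    have h1 : {x : Fin n → ℝ | x i = m}.indicator (1 : (Fin n → ℝ) → ℝ≥0∞) x = 0 :=
      Set.indicator_of_notMem (s := {x : Fin n → ℝ | x i = m}) hx _
    simp only [h1, lintegral_zero, mul_zero]
  simp only [h0, lintegral_zero] at h
  rw [Measure.restrict_eq_self_of_ae_mem
    (show ∀ᵐ ω ∂P, ω ∈ {ω | ∀ i, 0 < tau f N ω i} from hpos)] at h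
  have e1 : ∫⁻ ω, {x : Fin n → ℝ | x i = m}.indicator 1 (returns m β f N Z ε ω) ∂P =
      P (returns m β f N Z ε ⁻¹' {x | x i = m}) :=
    (lintegral_indicator_one (hX hs))
  rw [e1] at h
  exact measure_eq_zero_iff_ae_notMem.1 h

theorem jointMeasure_apply (hf : ∀ i, Measurable (f i)) (m β : ℝ)
    (K : Kernel (Fin n → ℝ) (Fin n → E)) [IsSFiniteKernel K]
    (hK : ∀ w, K w = weightedMoment ν f w) (x : Fin n → ℝ)
    {C : Set ((Fin n → E) × (Fin n → ℝ))} (hC : MeasurableSet C) :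
    jointMeasure ν f m β x C =
      ∫⁻ w, normalFactor m β x w * expNegLaplace ν (bigOmega f w) * K w {v | (v, w) ∈ C}
        ∂(orthantVolume n) := by
  have hswap : ∀ C : Set ((Fin n → E) × (Fin n → ℝ)), MeasurableSet C →
      Measurable fun w => K w {v | (v, w) ∈ C} := fun C hC =>
    Kernel.measurable_kernel_prodMk_left (κ := K) (measurable_swap hC)
  have hpair : ∀ w : Fin n → ℝ, Measurable fun v : Fin n → E => (v, w) := fun w =>
    measurable_prodMk_right
  have happly : ∀ C : Set ((Fin n → E) × (Fin n → ℝ)), MeasurableSet C → ∀ w,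
      (weightedMoment ν f w).map (fun v => (v, w)) C = K w {v | (v, w) ∈ C} := fun C hC w => by
    rw [Measure.map_apply (hpair w) hC, hK]; rfl
  have hmap : Measurable fun w => (weightedMoment ν f w).map (fun v => (v, w)) := by
    refine Measure.measurable_of_measurable_coe _ fun C hC => ?_
    simp_rw [happly C hC]
    exact hswap C hC
  have hd : Measurable fun w => expNegLaplace ν (bigOmega f w) * normalFactor m β x w :=
    (measurable_expNegLaplace hf).mul (Measurable.comp (f := fun w : Fin n → ℝ => (w, x))
      (measurable_normalFactor_swap m β) measurable_prodMk_right)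
  rw [jointMeasure, Measure.bind_apply hC hmap.aemeasurable]
  simp_rw [happly C hC]
  rw [lintegral_withDensity_eq_lintegral_mul _ hd (hswap C hC)]
  simp only [Pi.mul_apply, mul_comm (expNegLaplace ν _) (normalFactor m β x _)]

theorem IsModel.posterior_joint [StandardBorelSpace E] [Nonempty E]
    (hM : IsModel P ν f N Z ε V) (hf : ∀ i, Measurable (f i))
    (hΛ : ∀ w : Fin n → ℝ, (∀ i, 0 ≤ w i) → laplaceExponent ν (bigOmega f w) < ∞) (m β : ℝ) :
    ∀ᵐ x ∂(P.map (returns m β f N Z ε)), x ∈ {x : Fin n → ℝ | ∀ i, x i ≠ m} →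
      IsNormalization
        (condDistrib (fun ω => (V ω, latentW f N Z ω)) (returns m β f N Z ε) P x)
        (jointMeasure ν f m β x) := by
  obtain ⟨K, hKs, hK⟩ := exists_weightedMoment_kernel ν hf
  have hdens := measurable_joint_density (ν := ν) hf m β
  have hjm : ∀ C : Set ((Fin n → E) × (Fin n → ℝ)), MeasurableSet C →
      Measurable fun z : (Fin n → ℝ) × (Fin n → ℝ) =>
        normalFactor m β z.2 z.1 * expNegLaplace ν (bigOmega f z.1) * K z.1 {v | (v, z.1) ∈ C} :=
    fun C hC => hdens.mul (Measurable.comp (f := fun z : (Fin n → ℝ) × (Fin n → ℝ) => z.1)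
      (Kernel.measurable_kernel_prodMk_left (κ := K) (measurable_swap hC)) measurable_fst)
  let κ : Kernel (Fin n → ℝ) ((Fin n → E) × (Fin n → ℝ)) := ⟨jointMeasure ν f m β, by
    refine Measure.measurable_of_measurable_coe _ fun C hC => ?_
    simp_rw [jointMeasure_apply hf m β K hK _ hC]
    exact (hjm C hC).lintegral_prod_left'⟩
  refine ae_isNormalization_condDistrib P (hM.measurable_returns hf m β)
    (hM.measurable_V.prodMk (hM.measurable_latentW hf)) (measurableSet_forall_ne m) volume κ
    fun D hD hDA C hC => ?_
  have hT : MeasurableSet {z : ((Fin n → ℝ) × (Fin n → ℝ)) × (Fin n → E) |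
      z.1.2 ∈ D ∧ (z.2, z.1.1) ∈ C} :=
    ((measurable_snd.comp measurable_fst) hD).inter
      ((measurable_snd.prodMk (measurable_fst.comp measurable_fst)) hC)
  have h := hM.measure_joint hf hΛ m β K hK hT fun z hz => hDA hz.1
  refine Eq.trans h ?_
  have e1 : ∀ w x : Fin n → ℝ, normalFactor m β x w * expNegLaplace ν (bigOmega f w) *
      K w {v | ((w, x), v) ∈ {z : ((Fin n → ℝ) × (Fin n → ℝ)) × (Fin n → E) |
        z.1.2 ∈ D ∧ (z.2, z.1.1) ∈ C}} =
      D.indicator 1 x * (normalFactor m β x w * expNegLaplace ν (bigOmega f w) *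
        K w {v | (v, w) ∈ C}) := by
    intro w x
    by_cases hx : x ∈ D <;> simp [hx]
  simp_rw [e1]
  rw [lintegral_lintegral_swap (((measurable_one.indicator hD).comp measurable_snd).mul
    (hjm C hC)).aemeasurable, ← lintegral_indicator hD]
  refine lintegral_congr fun x => ?_
  have hx' : Measurable fun w : Fin n → ℝ =>
      normalFactor m β x w * expNegLaplace ν (bigOmega f w) * K w {v | (v, w) ∈ C} :=
    Measurable.comp (f := fun w : Fin n → ℝ => (w, x)) (hjm C hC) measurable_prodMk_right
  rw [lintegral_const_mul _ hx']
  by_cases hx : x ∈ D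
  · rw [Set.indicator_of_mem hx, Set.indicator_of_mem hx, Pi.one_apply, one_mul]
    exact (jointMeasure_apply hf m β K hK x hC).symm
  · rw [Set.indicator_of_notMem hx, Set.indicator_of_notMem hx, zero_mul]

/-- The normal factor and `e^{-Λ}` depend only on `(w, x)`, so they belong to the reference measure;
the remaining kernel in `v` is free of `x`. -/
theorem IsModel.posterior_V [StandardBorelSpace E] [Nonempty E]
    (hM : IsModel P ν f N Z ε V) (hf : ∀ i, Measurable (f i))
    (hΛ : ∀ w : Fin n → ℝ, (∀ i, 0 ≤ w i) → laplaceExponent ν (bigOmega f w) < ∞) (m β : ℝ) :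
    ∀ᵐ wx ∂(P.map fun ω => (latentW f N Z ω, returns m β f N Z ε ω)),
      wx ∈ {wx : (Fin n → ℝ) × (Fin n → ℝ) | ∀ i, wx.2 i ≠ m} →
      IsNormalization
        (condDistrib V (fun ω => (latentW f N Z ω, returns m β f N Z ε ω)) P wx)
        (weightedMoment ν f wx.1) := by
  obtain ⟨K, hKs, hK⟩ := exists_weightedMoment_kernel ν hf
  have hdens := measurable_joint_density (ν := ν) hf m β
  have h := ae_isNormalization_condDistrib P
    ((hM.measurable_latentW hf).prodMk (hM.measurable_returns hf m β)) hM.measurable_V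
    (measurable_snd (measurableSet_forall_ne m) :
      MeasurableSet {wx : (Fin n → ℝ) × (Fin n → ℝ) | ∀ i, wx.2 i ≠ m})
    (((orthantVolume n).prod volume).withDensity
      (fun z => normalFactor m β z.2 z.1 * expNegLaplace ν (bigOmega f z.1)))
    (K.comap Prod.fst measurable_fst) fun D hD hDA B hB => ?_
  · filter_upwards [h] with wx hwx hA
    simpa only [Kernel.comap_apply, hK] using hwx hA
  have hKf : Measurable fun z : (Fin n → ℝ) × (Fin n → ℝ) => K z.1 B :=
    (K.measurable_coe hB).comp measurable_fst
  have hT : MeasurableSet (D ×ˢ B) := hD.prod hB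
  have h := hM.measure_joint hf hΛ m β K hK hT fun z hz => hDA hz.1
  refine Eq.trans h ?_
  rw [← lintegral_indicator hD]
  simp only [Kernel.comap_apply]
  rw [lintegral_withDensity_eq_lintegral_mul _ hdens (hKf.indicator hD),
    lintegral_prod _ (hdens.mul (hKf.indicator hD)).aemeasurable]
  refine lintegral_congr fun w => lintegral_congr fun x => ?_
  rw [Pi.mul_apply]
  by_cases hx : (w, x) ∈ D <;> simp [hx]

omit [SigmaFinite ν] in
theorem scriptB_eq (w : Fin n → ℝ) : scriptB ν f w = weightedMoment ν f w Set.univ := by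
  rw [scriptB, weightedMoment, withDensity_apply _ MeasurableSet.univ, Measure.restrict_univ]

/-- The Palm formula with every `B_i` the whole space evaluates the expectation inside the
likelihood. -/
theorem likelihood_eq (hN : IsPoissonRandomMeasure P N ν) (hf : ∀ i, Measurable (f i))
    (hΛ : ∀ w : Fin n → ℝ, (∀ i, 0 ≤ w i) → laplaceExponent ν (bigOmega f w) < ∞) (m β : ℝ)
    (x : Fin n → ℝ) :
    likelihood P f N m β x =
      ∫⁻ w, scriptB ν f w * expNegLaplace ν (bigOmega f w) * normalFactor m β x w
        ∂(orthantVolume n) := by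
  refine lintegral_congr_ae ?_
  filter_upwards [ae_orthantVolume_pos n] with w hw
  rw [scriptB_eq, ← Set.pi_univ (Set.univ : Set (Fin n)), mul_comm, mul_comm (weightedMoment _ _ _ _),
    ← palm_formula_weights hN hf (fun i => (hw i).le) (hΛ w fun i => (hw i).le)
      fun _ => MeasurableSet.univ]
  congr 1
  refine lintegral_congr_ae ?_
  filter_upwards [ae_tau_lt_top hN hf hΛ] with ω hω
  refine Finset.prod_congr rfl fun i _ => ?_
  rw [Measure.restrict_univ, ENNReal.ofReal_mul (Real.exp_nonneg _),
    ENNReal.ofReal_toReal (hω i).ne,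
    ← negExp_ofReal (mul_nonneg (hw i).le ENNReal.toReal_nonneg), ENNReal.ofReal_mul (hw i).le,
    ENNReal.ofReal_toReal (hω i).ne]
  rfl

/-- Integrating out `v` replaces the weighted moment measure by its total mass `scriptB`. -/
theorem IsModel.posterior_W (hM : IsModel P ν f N Z ε V) (hf : ∀ i, Measurable (f i))
    (hΛ : ∀ w : Fin n → ℝ, (∀ i, 0 ≤ w i) → laplaceExponent ν (bigOmega f w) < ∞) (m β : ℝ) :
    ∀ᵐ x ∂(P.map (returns m β f N Z ε)), x ∈ {x : Fin n → ℝ | ∀ i, x i ≠ m} →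
      IsNormalization (condDistrib (latentW f N Z) (returns m β f N Z ε) P x)
        ((orthantVolume n).withDensity fun w =>
          scriptB ν f w * expNegLaplace ν (bigOmega f w) * normalFactor m β x w) := by
  obtain ⟨K, hKs, hK⟩ := exists_weightedMoment_kernel ν hf
  have hsB : ∀ w, scriptB ν f w = K w Set.univ := fun w => by rw [scriptB_eq, hK]
  have hKu : Measurable fun w => K w Set.univ := K.measurable_coe MeasurableSet.univ
  have hg : Measurable (Function.uncurry fun x w : Fin n → ℝ =>
      scriptB ν f w * expNegLaplace ν (bigOmega f w) * normalFactor m β x w) := by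
    simp_rw [hsB]
    exact ((hKu.mul (measurable_expNegLaplace hf)).comp measurable_snd).mul
      (measurable_normalFactor m β)
  have h := ae_isNormalization_condDistrib P (hM.measurable_returns hf m β)
    (hM.measurable_latentW hf) (measurableSet_forall_ne m) volume
    (Kernel.withDensity (Kernel.const (Fin n → ℝ) (orthantVolume n)) fun x w =>
      scriptB ν f w * expNegLaplace ν (bigOmega f w) * normalFactor m β x w)
    fun D hD hDA B hB => ?_
  · simpa only [Kernel.withDensity_apply _ hg, Kernel.const_apply] using h
  have hT : MeasurableSet {z : ((Fin n → ℝ) × (Fin n → ℝ)) × (Fin n → E) |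
      z.1.2 ∈ D ∧ z.1.1 ∈ B} :=
    ((measurable_snd.comp measurable_fst) hD).inter ((measurable_fst.comp measurable_fst) hB)
  have h := hM.measure_joint hf hΛ m β K hK hT fun z hz => hDA hz.1
  have hset : returns m β f N Z ε ⁻¹' D ∩ latentW f N Z ⁻¹' B =
      (fun ω => ((latentW f N Z ω, returns m β f N Z ε ω), V ω)) ⁻¹'
        {z : ((Fin n → ℝ) × (Fin n → ℝ)) × (Fin n → E) | z.1.2 ∈ D ∧ z.1.1 ∈ B} := rfl
  rw [hset, h]
  have e1 : ∀ w x : Fin n → ℝ, normalFactor m β x w * expNegLaplace ν (bigOmega f w) *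
      K w {v | ((w, x), v) ∈ {z : ((Fin n → ℝ) × (Fin n → ℝ)) × (Fin n → E) |
        z.1.2 ∈ D ∧ z.1.1 ∈ B}} =
      D.indicator 1 x * B.indicator (fun w => scriptB ν f w * expNegLaplace ν (bigOmega f w) *
        normalFactor m β x w) w := by
    intro w x
    by_cases hx : x ∈ D <;> by_cases hw : w ∈ B <;> simp [hx, hw, hsB]
    ring
  simp_rw [e1]
  have hBi : Measurable fun z : (Fin n → ℝ) × (Fin n → ℝ) => B.indicator (fun w =>
      scriptB ν f w * expNegLaplace ν (bigOmega f w) * normalFactor m β z.2 w) z.1 := by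
    have h1 := (hg.comp measurable_swap).indicator (measurable_fst hB :
      MeasurableSet (Prod.fst ⁻¹' B : Set ((Fin n → ℝ) × (Fin n → ℝ))))
    exact h1
  rw [lintegral_lintegral_swap (((measurable_one.indicator hD).comp measurable_snd).mul
    hBi).aemeasurable, ← lintegral_indicator hD]
  refine lintegral_congr fun x => ?_
  have hx' : Measurable (B.indicator fun w : Fin n → ℝ =>
      scriptB ν f w * expNegLaplace ν (bigOmega f w) * normalFactor m β x w) :=
    Measurable.comp (f := fun w : Fin n → ℝ => (w, x)) hBi measurable_prodMk_right
  rw [lintegral_const_mul _ hx']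
  by_cases hx : x ∈ D
  · rw [Set.indicator_of_mem hx, Set.indicator_of_mem hx, Pi.one_apply, one_mul,
      lintegral_indicator hB, Kernel.withDensity_apply' _ hg, Kernel.const_apply]
  · rw [Set.indicator_of_notMem hx, Set.indicator_of_notMem hx, zero_mul]

omit [SigmaFinite ν] in
theorem gigMeasure_smul_eq (m β : ℝ) (v : Fin n → E) {x : Fin n → ℝ} (hx : ∀ i, x i ≠ m) :
    ∃ c : ℝ≥0∞, c ≠ 0 ∧ c ≠ ∞ ∧
      (orthantVolume n).withDensity (fun w => expNegLaplace ν (bigOmega f w) *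
        (normalFactor m β x w *
          ∏ i, ENNReal.ofReal (Real.exp (-(w i * sumDistinct (f i) v))))) =
      c • gigMeasure ν f m β v x := by
  choose c hc h using fun i =>
    exists_gaussianPDF_mul_exp_eq m β (hx i) (sumDistinct_nonneg (f i) v)
  refine ⟨∏ i, ENNReal.ofReal (c i), ?_, ENNReal.prod_ne_top fun _ _ => ENNReal.ofReal_ne_top, ?_⟩
  · exact Finset.prod_ne_zero_iff.2 fun i _ => (ENNReal.ofReal_pos.2 (hc i)).ne'
  · rw [gigMeasure, ← withDensity_smul' _ _
      (ENNReal.prod_ne_top fun _ _ => ENNReal.ofReal_ne_top)]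
    refine withDensity_congr_ae ?_
    filter_upwards [ae_orthantVolume_pos n] with w hw
    rw [normalFactor, ← Finset.prod_mul_distrib, Finset.prod_congr rfl fun i _ => h i (w i) (hw i),
      Finset.prod_mul_distrib, Pi.smul_apply, smul_eq_mul]
    ring

/-- Bayes' rule with reference measure `untiltedMoment ⊗ dx` for `(V, X)`: all dependence on `w`
sits in the density `g`, which is the GIG density up to a factor in `(v, x)`. -/
theorem IsModel.posterior_W_of_noAtoms [MeasurableEq E]
    (hM : IsModel P ν f N Z ε V) (hf : ∀ i, Measurable (f i))
    (hΛ : ∀ w : Fin n → ℝ, (∀ i, 0 ≤ w i) → laplaceExponent ν (bigOmega f w) < ∞)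
    (hν : ∀ v, ν {v} = 0) (m β : ℝ) :
    ∀ᵐ vx ∂(P.map fun ω => (V ω, returns m β f N Z ε ω)),
      vx ∈ {vx : (Fin n → E) × (Fin n → ℝ) | ∀ i, vx.2 i ≠ m} →
      IsNormalization
        (condDistrib (latentW f N Z) (fun ω => (V ω, returns m β f N Z ε ω)) P vx)
        (gigMeasure ν f m β vx.1 vx.2) := by
  obtain ⟨K, hKs, hK⟩ := exists_weightedMoment_kernel ν hf
  have hs := fun i => measurable_sumDistinct (n := n) (hf i)
  have hex : Measurable fun z : (Fin n → ℝ) × (Fin n → E) =>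
      ∏ i, ENNReal.ofReal (Real.exp (-(z.1 i * sumDistinct (f i) z.2))) := by
    have h1 := fun i => (hs i).comp (measurable_snd :
      Measurable (Prod.snd : (Fin n → ℝ) × (Fin n → E) → (Fin n → E)))
    simp only [Function.comp_def] at h1
    fun_prop
  let g : ((Fin n → E) × (Fin n → ℝ)) → (Fin n → ℝ) → ℝ≥0∞ := fun vx w =>
    expNegLaplace ν (bigOmega f w) * (normalFactor m β vx.2 w *
      ∏ i, ENNReal.ofReal (Real.exp (-(w i * sumDistinct (f i) vx.1))))
  have hg : Measurable (Function.uncurry g) :=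
    ((measurable_expNegLaplace hf).comp measurable_snd).mul
      ((Measurable.comp (f := fun z : ((Fin n → E) × (Fin n → ℝ)) × (Fin n → ℝ) => (z.1.2, z.2))
        (measurable_normalFactor m β)
        ((measurable_snd.comp measurable_fst).prodMk measurable_snd)).mul
      (Measurable.comp (f := fun z : ((Fin n → E) × (Fin n → ℝ)) × (Fin n → ℝ) => (z.2, z.1.1))
        hex (measurable_snd.prodMk (measurable_fst.comp measurable_fst))))
  have h := ae_isNormalization_condDistrib P
    (hM.measurable_V.prodMk (hM.measurable_returns hf m β)) (hM.measurable_latentW hf)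
    (measurable_snd (measurableSet_forall_ne m) :
      MeasurableSet {vx : (Fin n → E) × (Fin n → ℝ) | ∀ i, vx.2 i ≠ m})
    ((untiltedMoment ν f).prod volume)
    (Kernel.withDensity (Kernel.const _ (orthantVolume n)) g) fun D hD hDA B hB => ?_
  · filter_upwards [h] with vx hvx hA
    obtain ⟨c, hc0, hc, hceq⟩ := gigMeasure_smul_eq (ν := ν) (f := f) m β vx.1 hA
    refine IsNormalization.of_smul hc0 hc ?_ (hvx hA)
    rw [Kernel.withDensity_apply _ hg, Kernel.const_apply, ← hceq]
  have hT : MeasurableSet {z : ((Fin n → ℝ) × (Fin n → ℝ)) × (Fin n → E) |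
      (z.2, z.1.2) ∈ D ∧ z.1.1 ∈ B} :=
    ((measurable_snd.prodMk (measurable_snd.comp measurable_fst)) hD).inter
      ((measurable_fst.comp measurable_fst) hB)
  have h := hM.measure_joint hf hΛ m β K hK hT fun z hz => hDA hz.1
  have hset : (fun ω => (V ω, returns m β f N Z ε ω)) ⁻¹' D ∩ latentW f N Z ⁻¹' B =
      (fun ω => ((latentW f N Z ω, returns m β f N Z ε ω), V ω)) ⁻¹'
        {z : ((Fin n → ℝ) × (Fin n → ℝ)) × (Fin n → E) | (z.2, z.1.2) ∈ D ∧ z.1.1 ∈ B} := rfl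
  rw [hset, h]
  let Φ : (Fin n → ℝ) → ((Fin n → E) × (Fin n → ℝ)) → ℝ≥0∞ := fun w vx =>
    D.indicator 1 vx * B.indicator (g vx) w
  have hΦ : Measurable (Function.uncurry Φ) :=
    ((measurable_one.indicator hD).comp measurable_snd).mul
      ((hg.comp measurable_swap).indicator (measurable_fst hB :
        MeasurableSet (Prod.fst ⁻¹' B : Set ((Fin n → ℝ) × ((Fin n → E) × (Fin n → ℝ))))))
  have e1 : ∀ w x : Fin n → ℝ, normalFactor m β x w * expNegLaplace ν (bigOmega f w) *
      K w {v | ((w, x), v) ∈ {z : ((Fin n → ℝ) × (Fin n → ℝ)) × (Fin n → E) |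
        (z.2, z.1.2) ∈ D ∧ z.1.1 ∈ B}} = ∫⁻ v, Φ w (v, x) ∂(untiltedMoment ν f) := by
    intro w x
    have hex' : Measurable fun v : Fin n → E =>
        ∏ i, ENNReal.ofReal (Real.exp (-(w i * sumDistinct (f i) v))) :=
      Measurable.comp (f := fun v : Fin n → E => (w, v)) hex measurable_prodMk_left
    have hset' : MeasurableSet {v | ((w, x), v) ∈
        {z : ((Fin n → ℝ) × (Fin n → ℝ)) × (Fin n → E) | (z.2, z.1.2) ∈ D ∧ z.1.1 ∈ B}} :=
      measurable_prodMk_left hT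
    rw [hK, weightedMoment_of_noAtoms hν hf, withDensity_apply _ hset',
      ← lintegral_indicator hset', ← lintegral_const_mul _ (hex'.indicator hset')]
    refine lintegral_congr fun v => ?_
    by_cases hx : (v, x) ∈ D <;> by_cases hw : w ∈ B <;> simp [Φ, g, hx, hw]
    ring
  have e2 : ∀ w, ∫⁻ x, ∫⁻ v, Φ w (v, x) ∂(untiltedMoment ν f) ∂volume =
      ∫⁻ vx, Φ w vx ∂((untiltedMoment ν f).prod volume) := fun w =>
    (lintegral_prod_symm' _ (Measurable.comp (f := fun vx : (Fin n → E) × (Fin n → ℝ) => (w, vx))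
      hΦ measurable_prodMk_left)).symm
  simp_rw [e1, e2]
  rw [lintegral_lintegral_swap hΦ.aemeasurable, ← lintegral_indicator hD]
  refine lintegral_congr fun vx => ?_
  have hBg : Measurable (B.indicator (g vx)) :=
    (Measurable.comp (f := fun w : Fin n → ℝ => (vx, w)) hg measurable_prodMk_left).indicator hB
  rw [lintegral_const_mul _ hBg]
  by_cases hx : vx ∈ D
  · rw [Set.indicator_of_mem hx, Set.indicator_of_mem hx, Pi.one_apply, one_mul,
      lintegral_indicator hB, Kernel.withDensity_apply' _ hg, Kernel.const_apply]
  · rw [Set.indicator_of_notMem hx, Set.indicator_of_notMem hx, zero_mul]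

end Posterior

end GHVol

end

/-! ### The theorem. -/

open GHVol in
theorem theorem3p2 {n : ℕ} {S E : Type*} [MeasurableSpace S]
    [TopologicalSpace E] [PolishSpace E] [MeasurableSpace E] [BorelSpace E] [Nonempty E]
    (P : Measure S) [IsProbabilityMeasure P] (ν : Measure E) [SigmaFinite ν]
    (f : Fin n → E → ℝ≥0) (hf : ∀ i, Measurable (f i))
    (hΛ : ∀ w : Fin n → ℝ, (∀ i, 0 ≤ w i) → laplaceExponent ν (bigOmega f w) < ∞)
    (μ Δ β : ℝ) (N : S → Measure E) (Z ε : S → Fin n → ℝ) (V : S → Fin n → E)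
    (hM : IsModel P ν f N Z ε V)
    (X W : S → Fin n → ℝ) (hX : X = returns (μ * Δ) β f N Z ε) (hW : W = latentW f N Z) :
    -- values with some `x_i = μΔ` are negligible when all `τ_i > 0`
    ((∀ᵐ ω ∂P, ∀ i, 0 < tau f N ω i) → ∀ᵐ x ∂(P.map X), ∀ i, x i ≠ μ * Δ) ∧
    -- the joint posterior of `V, W | X`
    (∀ᵐ x ∂(P.map X), (∀ i, x i ≠ μ * Δ) →
      IsNormalization (condDistrib (fun ω => (V ω, W ω)) X P x)
        (jointMeasure ν f (μ * Δ) β x)) ∧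
    -- (i) the posterior of `W | V, X`
    ((∀ v : E, ν {v} = 0) →
      ∀ᵐ vx ∂(P.map (fun ω => (V ω, X ω))), (∀ i, vx.2 i ≠ μ * Δ) →
        IsNormalization (condDistrib W (fun ω => (V ω, X ω)) P vx)
          (gigMeasure ν f (μ * Δ) β vx.1 vx.2)) ∧
    -- (ii) the posterior of `V | W, X`
    ((∀ᵐ wx ∂(P.map (fun ω => (W ω, X ω))), (∀ i, wx.2 i ≠ μ * Δ) →
        IsNormalization (condDistrib V (fun ω => (W ω, X ω)) P wx)
          (weightedMoment ν f wx.1)) ∧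
      ∀ w : Fin n → ℝ, weightedMoment ν f w = weightedMomentByCells ν f w) ∧
    -- (iii) the posterior density of `W | X`
    (∀ᵐ x ∂(P.map X), (∀ i, x i ≠ μ * Δ) →
      0 < likelihood P f N (μ * Δ) β x ∧ likelihood P f N (μ * Δ) β x < ∞ ∧
      condDistrib W X P x = (orthantVolume n).withDensity (fun w =>
        scriptB ν f w * expNegLaplace ν (bigOmega f w) * normalFactor (μ * Δ) β x w /
          likelihood P f N (μ * Δ) β x)) := by
  subst hX hW
  refine ⟨hM.ae_returns_ne hf hΛ (μ * Δ) β, hM.posterior_joint hf hΛ (μ * Δ) β,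
    fun hν => hM.posterior_W_of_noAtoms hf hΛ hν (μ * Δ) β,
    ⟨hM.posterior_V hf hΛ (μ * Δ) β, weightedMoment_eq_weightedMomentByCells ν f⟩, ?_⟩
  filter_upwards [hM.posterior_W hf hΛ (μ * Δ) β] with x hx hxA
  obtain ⟨h1, h2, h3⟩ := hx hxA
  -- The normalizing mass of the posterior of `W` is the likelihood, so its positivity and
  -- finiteness come with the normalization.
  rw [withDensity_apply _ MeasurableSet.univ, Measure.restrict_univ,
    ← likelihood_eq hM.poisson hf hΛ (μ * Δ) β x] at h1 h2 h3
  refine ⟨h1, h2, ?_⟩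
  rw [h3, ← withDensity_smul' _ _ (ENNReal.inv_ne_top.2 h1.ne')]
  congr 1
  funext w
  rw [Pi.smul_apply, smul_eq_mul, ENNReal.div_eq_inv_mul]
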